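/- Let $\alpha,q,s>0$ and let $C_{A1},C_{A2},C_{B1},C_{B2},C_{B3}$ be real numbers. There exists a constant $C>0$, depending only on these eight numbers, such that the following holds. Let $\mathcal G=(\mathcal V,\mathcal E)$ be a simple graph with finite or countable vertex set in which every vertex has degree at most $\kappa$, and let $k\ge 1$ be an integer with $s\le \frac{\alpha q}{2k\alpha+kq}$. Let $v(x)$, $x\in\mathcal V$, be independent identically distributed real random variables on a probability space $(\Omega,\mathbb P)$ whose distribution $\mu$ satisfies $\mu[t-\epsilon,t+\epsilon]\le C_{A1}\epsilon^{\alpha}$ for all $t\in\mathbb R$, $\epsilon>0$, and $\int|t|^q\,d\mu(t)\le C_{A2}$. Let $A(x),B(x)$ be Hermitian $k\times k$ matrices with $A(x)$ invertible, $\|A(x)\|,\|A(x)^{-1}\|\le C_{B1}$ and $\|B(x)\|\le C_{B2}$, and for adjacent $x,y$ let $K(x,y)$ be a $k\times k$ matrix with $K(y,x)=K(x,y)^*$ and $\|K(x,y)\|\le C_{B3}$ (operator norms). Set $V(x)=v(x)A(x)+B(x)$, let $g>0$, and let $H$ be the random operator on $\ell^2(\mathcal V)\otimes\mathbb C^k$,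 $$(H\psi)(x)=V(x)\psi(x)+g^{-1}\sum_{y\sim x}K(x,y)\psi(y),$$ on its maximal domain $\{\psi : H\psi\in\ell^2(\mathcal V)\otimes\mathbb C^k\}$. Then the resolvent $G_z=(H-z)^{-1}$ exists for every $z\in\mathbb C\setminus\mathbb R$; denote its $k\times k$ matrix elements by $G_z(x,y)$. Moreover, for every $\lambda\in\mathbb R$ with $g\ge C\kappa^{1/s}/(1+|\lambda|)$ and all $x,y\in\mathcal V$: the limit $G_{\lambda+i0}(x,y)=\lim_{\epsilon\to+0}G_{\lambda+i\epsilon}(x,y)$ exists almost surely, $$\lim_{\epsilon\to+0}\mathbb E\|G_{\lambda+i\epsilon}(x,y)\|^s=\mathbb E\|G_{\lambda+i0}(x,y)\|^s,$$ and $$\mathbb E\|G_{\lambda+i0}(x,y)\|^s\le\frac{C}{(1+|\lambda|)^s}\left(\frac{C\kappa}{g^s(1+|\lambda|)^s}\right)^{\mathrm{dist}(x,y)},$$ where $\mathrm{dist}$ is the graph distance and the right-hand side is read as $0$ if $x$ and $y$ are not connected by a path. -/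

import Mathlib

open MeasureTheory ProbabilityTheory Filter Topology
open scoped Matrix Matrix.Norms.L2Operator ENNReal

universe u w

noncomputable section

/-- `k × k` complex matrices; `‖·‖` on them is the operator norm of `ℂᵏ` with its Euclidean norm. -/
abbrev Mat (k : ℕ) : Type := Matrix (Fin k) (Fin k) ℂ

/-- The fibre `ℂᵏ` with the Euclidean norm. -/
abbrev Fib (k : ℕ) : Type := EuclideanSpace ℂ (Fin k)

/-- The Hilbert space `ℓ²(V) ⊗ ℂᵏ` of square-summable functions `ψ : V → ℂᵏ`. -/
abbrev L2 (V : Type u) (k : ℕ) : Type u := lp (fun _ : V => Fib k) 2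

/-- `μ` is `α`-regular with constant `C`. -/
def IsAlphaRegular (μ : Measure ℝ) (α C : ℝ) : Prop :=
  ∀ t ε : ℝ, 0 < ε → μ (Set.Icc (t - ε) (t + ε)) ≤ ENNReal.ofReal (C * ε ^ α)

/-- `μ` has a finite absolute `q`-moment, bounded by `C`. -/
def HasMomentBound (μ : Measure ℝ) (q C : ℝ) : Prop :=
  ∫⁻ t, ENNReal.ofReal (|t| ^ q) ∂μ ≤ ENNReal.ofReal C

/-- The matrix potential `V(x) = v(x) A(x) + B(x)`. -/
def sitePotential {V : Type u} {k : ℕ} (A B : V → Mat k) (v : V → ℝ) (x : V) : Mat k :=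
  ((v x : ℝ) : ℂ) • A x + B x

/-- The expression `(Hψ)(x) = W(x) ψ(x) + g⁻¹ ∑_{y ∼ x} K(x,y) ψ(y)` for arbitrary `ψ : V → ℂᵏ`. -/
def formalHam {V : Type u} {k : ℕ} (G : SimpleGraph V) [G.LocallyFinite]
    (K : V → V → Mat k) (g : ℝ) (W : V → Mat k) : (V → Fib k) →ₗ[ℂ] (V → Fib k) where
  toFun ψ x := Matrix.toEuclideanLin (W x) (ψ x)
    + ((g⁻¹ : ℝ) : ℂ) • ∑ y ∈ G.neighborFinset x, Matrix.toEuclideanLin (K x y) (ψ y)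
  map_add' ψ φ := by
    funext x
    simp only [Pi.add_apply, map_add, Finset.sum_add_distrib, smul_add]
    abel
  map_smul' c ψ := by
    funext x
    simp only [Pi.smul_apply, map_smul, RingHom.id_apply, smul_add, ← Finset.smul_sum]
    rw [smul_comm]

/-- The Hamiltonian as an (in general unbounded) operator on `ℓ²(V) ⊗ ℂᵏ`, on its maximal domain
`{ψ ∈ ℓ² | Hψ ∈ ℓ²}`. -/
def hamiltonian {V : Type u} {k : ℕ} (G : SimpleGraph V) [G.LocallyFinite]
    (K : V → V → Mat k) (g : ℝ) (W : V → Mat k) : L2 V k →ₗ.[ℂ] L2 V k where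
  domain :=
    { carrier := {ψ | Memℓp (formalHam G K g W (ψ : V → Fib k)) 2}
      zero_mem' := by
        simp only [Set.mem_ofPred_eq, lp.coeFn_zero, map_zero]
        exact zero_memℓp
      add_mem' := by
        intro ψ φ hψ hφ
        simp only [Set.mem_ofPred_eq, lp.coeFn_add, map_add] at hψ hφ ⊢
        exact hψ.add hφ
      smul_mem' := by
        intro c ψ hψ
        simp only [Set.mem_ofPred_eq, lp.coeFn_smul, map_smul] at hψ ⊢
        exact hψ.const_smul c }
  toFun :=
    { toFun := fun ψ => ⟨formalHam G K g W (ψ.1 : V → Fib k), ψ.2⟩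
      map_add' := by
        intro ψ φ
        apply Subtype.ext
        simp only [Submodule.coe_add, lp.coeFn_add, map_add]
        rfl
      map_smul' := by
        intro c ψ
        apply Subtype.ext
        simp only [Submodule.coe_smul, lp.coeFn_smul, map_smul]
        rfl }

/-- `R` is the resolvent `(T - z)⁻¹`: a bounded, everywhere defined, two-sided inverse of
`T - z : dom T → E`. -/
def IsResolventAt {E : Type*} [NormedAddCommGroup E] [NormedSpace ℂ E]
    (T : E →ₗ.[ℂ] E) (z : ℂ) (R : E →L[ℂ] E) : Prop :=
  (∀ φ : E, ∃ h : R φ ∈ T.domain, T ⟨R φ, h⟩ - z • R φ = φ) ∧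
  (∀ ψ : T.domain, R (T ψ - z • (ψ : E)) = ψ)

open Classical in
/-- The resolvent `(T - z)⁻¹`, and `0` when `z` is in the spectrum of `T`. -/
def resolventOp {E : Type*} [NormedAddCommGroup E] [NormedSpace ℂ E]
    (T : E →ₗ.[ℂ] E) (z : ℂ) : E →L[ℂ] E :=
  if h : ∃ R, IsResolventAt T z R then h.choose else 0

open Classical in
/-- The matrix element `T(x,y)`, a `k × k` matrix: `T(x,y) u = (T (δ_y ⊗ u))(x)`. -/
def kernelAt {V : Type u} {k : ℕ} (T : L2 V k →L[ℂ] L2 V k) (x y : V) : Mat k :=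
  Matrix.of fun i j => (T (lp.single 2 y (EuclideanSpace.single j (1 : ℂ)))) x i

/-- The Green function `G_z(x,y)` of the Hamiltonian. -/
def green {V : Type u} {k : ℕ} (G : SimpleGraph V) [G.LocallyFinite]
    (K : V → V → Mat k) (g : ℝ) (W : V → Mat k) (z : ℂ) (x y : V) : Mat k :=
  kernelAt (resolventOp (hamiltonian G K g W) z) x y

/-- The boundary value `G_{λ+i0}(x,y) = lim_{ε → +0} G_{λ+iε}(x,y)`. -/
def greenBoundary {V : Type u} {k : ℕ} (G : SimpleGraph V) [G.LocallyFinite]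
    (K : V → V → Mat k) (g : ℝ) (W : V → Mat k) (lam : ℝ) (x y : V) : Mat k :=
  limUnder (𝓝[>] (0 : ℝ)) fun ε : ℝ => green G K g W ((lam : ℂ) + (ε : ℂ) * Complex.I) x y

/-- The fractional moment `⟨‖M‖^s⟩` of a random matrix. -/
def fracMoment {Ω : Type w} [MeasurableSpace Ω] (P : Measure Ω) {k : ℕ} (s : ℝ)
    (M : Ω → Mat k) : ℝ≥0∞ :=
  ∫⁻ ω, ENNReal.ofReal (‖M ω‖ ^ s) ∂P

open Classical in
/-- `r ^ dist(x,y)`, with value `0` when `dist(x,y) = ∞`. -/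
def powDist {V : Type u} (G : SimpleGraph V) (r : ℝ) (x y : V) : ℝ :=
  if G.Reachable x y then r ^ G.dist x y else 0

end

/-! Fix all potentials except v(x) = t. Changing t perturbs H at one site only, so the resolvent
identity gives G_z(x,y) = (1 + tN)⁻¹F with N and F independent of t. By Cramer's rule the entries
are rational in t, with numerators of degree at most k - 1 and a common denominator of degree at
most k. Under an α-regular law with a q-th moment, the s-th moment of such a function cannot
concentrate on a set of small measure, provided s((2k - 1)/q + k/α) < 1
(`exists_rational_decoupling`). Off a set of small measure, V(x) - z expands by a factor of order 1
+ |λ| (`exists_expanding`). Hence (1 + |λ|)^s E‖G_z(x,y)‖^s ≤ c E‖(V(x) - z)G_z(x,y)‖^s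
(`exists_pencil_decoupling`, then averaging over the other sites).

The equation (H - z)G_z = 1 expresses (V(x) - z)G_z(x,y) through the neighbours of x. As s ≤ 1, the
moments m(x) = E‖G_z(x,y)‖^s satisfy m(x) ≤ aδ_{xy} + ρ∑_{u∼x} m(u) with a = c/(1 + |λ|)^s and ρ =
a(|C_{B3}|/g)^s. The condition on g gives κρ ≤ 1/2, so iteration contracts. The trivial resolvent
bound, finite for each ε, removes the remainder. What is left is m(x) ≤ 2a(κρ)^{dist(x,y)} and ∑
m(x) ≤ 2a, uniformly in 0 < ε ≤ 1 (`IsBoundedHopping.moment_bounds`).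

For the boundary values, ‖G_{λ+iε}φ‖ increases as ε decreases to 0, and if it stays bounded then
G_{λ+iε}φ converges in norm. The bound on ∑ m(x) controls the s-th moment of the ℓ² norm of a column
of G, so the supremum over ε is integrable. It is therefore almost surely finite, and also dominates
the moments (`IsBoundedHopping.tendsto_boundary`).

The constant does not depend on k, because the bound on s leaves only finitely many k. -/

/-- A Hermitian, uniformly bounded hopping on a graph of bounded degree. -/
structure IsBoundedHopping {V : Type u} {k : ℕ} (G : SimpleGraph V) [G.LocallyFinite]
    (K : V → V → Mat k) (κ : ℕ) (c : ℝ) : Prop where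
  degree_le : ∀ x, G.degree x ≤ κ
  conj : ∀ x y, G.Adj x y → K y x = (K x y)ᴴ
  norm_le : ∀ x y, G.Adj x y → ‖K x y‖ ≤ c

/-- `ψ` lies in the maximal domain and `(H - z) ψ = φ`. -/
def Solves {V : Type u} {k : ℕ} (G : SimpleGraph V) [G.LocallyFinite]
    (K : V → V → Mat k) (g : ℝ) (W : V → Mat k) (z : ℂ) (ψ φ : L2 V k) : Prop :=
  ∀ x, formalHam G K g W ψ x - z • ψ x = φ x

/-! ### Self-adjointness of the Hamiltonian and existence of the resolvent -/

section Operator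

variable {V : Type u} {k : ℕ} {G : SimpleGraph V} [G.LocallyFinite] {K : V → V → Mat k}
  {κ : ℕ} {c g : ℝ} {W : V → Mat k} {z : ℂ}

lemma Solves.memℓp {ψ φ : L2 V k} (h : Solves G K g W z ψ φ) :
    Memℓp (formalHam G K g W (ψ : V → Fib k)) 2 := by
  have : formalHam G K g W (ψ : V → Fib k) = ((φ + z • ψ : L2 V k) : V → Fib k) := by
    funext x
    rw [lp.coeFn_add, Pi.add_apply, ← h x, lp.coeFn_smul, Pi.smul_apply, sub_add_cancel]
  rw [this]
  exact lp.memℓp _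

lemma Solves.sub {ψ φ ψ' φ' : L2 V k} (h : Solves G K g W z ψ φ) (h' : Solves G K g W z ψ' φ') :
    Solves G K g W z (ψ - ψ') (φ - φ') := by
  intro x
  rw [lp.coeFn_sub, lp.coeFn_sub, map_sub, Pi.sub_apply, Pi.sub_apply, Pi.sub_apply, ← h x,
    ← h' x, smul_sub]
  abel

lemma Solves.shift {ψ φ : L2 V k} (h : Solves G K g W z ψ φ) (z' : ℂ) :
    Solves G K g W z' ψ (φ + (z - z') • ψ) := by
  intro x
  rw [lp.coeFn_add, Pi.add_apply, ← h x, lp.coeFn_smul, Pi.smul_apply, sub_smul]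
  abel

lemma Solves.eq_of_isResolventAt {R : L2 V k →L[ℂ] L2 V k}
    (hR : IsResolventAt (hamiltonian G K g W) z R) {ψ φ : L2 V k}
    (h : Solves G K g W z ψ φ) : R φ = ψ := by
  have h2 := hR.2 ⟨ψ, h.memℓp⟩
  have : φ = (hamiltonian G K g W) ⟨ψ, h.memℓp⟩ - z • ψ := by
    apply lp.ext
    funext x
    exact (h x).symm
  rw [this]
  exact h2

lemma IsResolventAt.solves {R : L2 V k →L[ℂ] L2 V k}
    (hR : IsResolventAt (hamiltonian G K g W) z R) (φ : L2 V k) : Solves G K g W z (R φ) φ := by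
  intro x
  obtain ⟨h, h1⟩ := hR.1 φ
  have := congrArg (fun f : L2 V k => (f : V → Fib k) x) h1
  exact this

lemma inner_toEuclideanLin_left (M : Mat k) (u v : Fib k) :
    inner ℂ (Matrix.toEuclideanLin M u) v = inner ℂ u (Matrix.toEuclideanLin Mᴴ v) := by
  rw [Matrix.toEuclideanLin_conjTranspose_eq_adjoint, LinearMap.adjoint_inner_right]

lemma norm_toEuclideanLin_le (M : Mat k) (u : Fib k) :
    ‖Matrix.toEuclideanLin M u‖ ≤ ‖M‖ * ‖u‖ := Matrix.l2_opNorm_mulVec M u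

lemma im_inner_toEuclideanLin_self {M : Mat k} (hM : M.IsHermitian) (u : Fib k) :
    (inner ℂ u (Matrix.toEuclideanLin M u)).im = 0 := by
  have h := inner_toEuclideanLin_left M u u
  rw [hM.eq] at h
  have h2 := inner_conj_symm (𝕜 := ℂ) u (Matrix.toEuclideanLin M u)
  rw [h] at h2
  exact Complex.conj_eq_iff_im.1 h2

lemma summable_norm_sq (ψ : L2 V k) : Summable fun x => ‖ψ x‖ ^ 2 := by
  have := (lp.hasSum_norm (p := 2) (by simp) ψ).summable
  simpa using this

open Classical in
-- The imaginary part of ⟨ψ(x), K(x,y)ψ(y)⟩ changes sign when x and y are exchanged. The double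
-- series converges absolutely because degrees and hopping norms are bounded, so it vanishes and may
-- be summed along rows.
lemma IsBoundedHopping.hasSum_im_hopping (hK : IsBoundedHopping G K κ c) (ψ : L2 V k) :
    HasSum (fun x => ∑ y ∈ G.neighborFinset x,
      (inner ℂ (ψ x) (Matrix.toEuclideanLin (K x y) (ψ y))).im) 0 := by
  set a : V × V → ℝ := fun p =>
    if G.Adj p.1 p.2 then (inner ℂ (ψ p.1) (Matrix.toEuclideanLin (K p.1 p.2) (ψ p.2))).im else 0
    with ha
  set b : V × V → ℝ := fun p => if G.Adj p.1 p.2 then ‖ψ p.1‖ ^ 2 else 0 with hb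
  have hsum : ∀ (f : V → ℝ) (x : V), HasSum (fun y => if G.Adj x y then f y else 0)
      (∑ y ∈ G.neighborFinset x, f y) := by
    intro f x
    have := hasSum_sum_of_ne_finset_zero (L := .unconditional V) (f := fun y => if G.Adj x y then f y else 0)
      (s := G.neighborFinset x) (by
        intro y hy
        rw [SimpleGraph.mem_neighborFinset] at hy
        simp [hy])
    convert this using 1
    refine Finset.sum_congr rfl fun y hy => ?_
    rw [SimpleGraph.mem_neighborFinset] at hy
    simp [hy]
  -- Each term ‖ψ(x)‖² is repeated at most κ times, once for each neighbour of x.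
  have hbs : Summable b := by
    rw [summable_prod_of_nonneg (fun p => by simp only [hb]; split_ifs <;> positivity)]
    refine ⟨fun x => (hsum (fun _ => ‖ψ x‖ ^ 2) x).summable, ?_⟩
    refine Summable.of_nonneg_of_le (fun x => tsum_nonneg fun y => ?_) (fun x => ?_)
      ((summable_norm_sq ψ).mul_left (κ : ℝ))
    · simp only [hb]; split_ifs <;> positivity
    · simp only [hb]
      rw [(hsum (fun _ => ‖ψ x‖ ^ 2) x).tsum_eq, Finset.sum_const, nsmul_eq_mul,
        SimpleGraph.card_neighborFinset_eq_degree]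
      gcongr
      exact hK.degree_le x
  have hbs' : Summable (b ∘ Prod.swap) := (Equiv.prodComm V V).summable_iff.2 hbs
  have has : Summable a := by
    refine Summable.of_norm_bounded (g := fun p => |c| * (b p + (b ∘ Prod.swap) p))
      ((hbs.add hbs').mul_left _) ?_
    rintro ⟨x, y⟩
    simp only [ha, hb, Function.comp, Prod.swap]
    by_cases h : G.Adj x y
    · simp only [h, h.symm, if_true, Real.norm_eq_abs]
      refine (Complex.abs_im_le_norm _).trans ((norm_inner_le_norm _ _).trans ?_)
      have h1 : ‖Matrix.toEuclideanLin (K x y) (ψ y)‖ ≤ |c| * ‖ψ y‖ :=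
        (norm_toEuclideanLin_le _ _).trans (by
          gcongr; exact (hK.norm_le x y h).trans (le_abs_self c))
      calc ‖ψ x‖ * ‖Matrix.toEuclideanLin (K x y) (ψ y)‖ ≤ ‖ψ x‖ * (|c| * ‖ψ y‖) := by gcongr
        _ = |c| * (‖ψ x‖ * ‖ψ y‖) := by ring
        _ ≤ |c| * (‖ψ x‖ ^ 2 + ‖ψ y‖ ^ 2) := by
          gcongr
          nlinarith [sq_nonneg (‖ψ x‖ - ‖ψ y‖), sq_nonneg (‖ψ x‖), sq_nonneg (‖ψ y‖)]
    · have h' : ¬ G.Adj y x := fun h' => h h'.symm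
      simp [h, h']
  have hanti : ∀ p : V × V, a p.swap = - a p := by
    rintro ⟨x, y⟩
    simp only [ha, Prod.swap]
    by_cases h : G.Adj x y
    · simp only [h, h.symm, if_true]
      rw [hK.conj x y h, ← inner_toEuclideanLin_left, ← inner_conj_symm, Complex.conj_im]
    · have h' : ¬ G.Adj y x := fun h' => h h'.symm
      simp [h, h']
  have hzero : ∑' p, a p = 0 := by
    have h1 : ∑' p : V × V, a p.swap = ∑' p, a p := (Equiv.prodComm V V).tsum_eq a
    simp only [hanti, tsum_neg] at h1
    linarith
  have h2 := has.hasSum.prod_fiberwise fun x => hsum _ x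
  rwa [hzero] at h2

/-- The potential may be unbounded, so ⟨ψ, Wψ⟩ need not converge as a series. Imaginary parts are
therefore taken site by site, where the Hermitian W(x) contributes nothing, and only then summed. -/
lemma IsBoundedHopping.im_inner_eq (hK : IsBoundedHopping G K κ c) (hW : ∀ x, (W x).IsHermitian)
    {ψ φ : L2 V k} (h : Solves G K g W z ψ φ) :
    (inner ℂ ψ φ).im = - z.im * ‖ψ‖ ^ 2 := by
  have h1 := Complex.hasSum_im (lp.hasSum_inner ψ φ)
  have h2 : HasSum (fun x => ‖ψ x‖ ^ 2) (‖ψ‖ ^ 2) := by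
    have := lp.hasSum_norm (p := 2) (by simp) ψ
    simpa using this
  have h3 := ((hK.hasSum_im_hopping ψ).mul_left g⁻¹).add (h2.mul_left (-z.im))
  rw [mul_zero, zero_add] at h3
  have h5 : (fun x => (inner ℂ (ψ x) (φ x)).im) = fun x => g⁻¹ * ∑ y ∈ G.neighborFinset x,
      (inner ℂ (ψ x) (Matrix.toEuclideanLin (K x y) (ψ y))).im + -z.im * ‖ψ x‖ ^ 2 := by
    funext x
    have h4 : (inner ℂ (ψ x) (ψ x) : ℂ) = ((‖ψ x‖ ^ 2 : ℝ) : ℂ) := by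
      rw [inner_self_eq_norm_sq_to_K]; norm_cast
    rw [← h x, inner_sub_right, inner_smul_right, h4]
    simp only [formalHam, LinearMap.coe_mk, AddHom.coe_mk, inner_add_right, inner_smul_right,
      Complex.sub_im, Complex.add_im, im_inner_toEuclideanLin_self (hW x), inner_sum,
      Complex.im_ofReal_mul, Complex.im_sum, zero_add, Complex.im_mul_ofReal]
    ring
  rw [h5] at h1
  exact h1.unique h3

lemma IsBoundedHopping.norm_le_of_solves (hK : IsBoundedHopping G K κ c)
    (hW : ∀ x, (W x).IsHermitian) {ψ φ : L2 V k} (h : Solves G K g W z ψ φ) :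
    |z.im| * ‖ψ‖ ≤ ‖φ‖ := by
  have h1 := hK.im_inner_eq hW h
  have h2 : |z.im| * ‖ψ‖ ^ 2 ≤ ‖ψ‖ * ‖φ‖ := by
    calc |z.im| * ‖ψ‖ ^ 2 = |(inner ℂ ψ φ : ℂ).im| := by
          rw [h1, abs_mul, abs_neg, abs_of_nonneg (sq_nonneg ‖ψ‖)]
      _ ≤ ‖(inner ℂ ψ φ : ℂ)‖ := Complex.abs_im_le_norm _
      _ ≤ _ := norm_inner_le_norm _ _
  rcases (norm_nonneg ψ).eq_or_lt with h0 | h0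
  · rw [← h0]; simp
  · nlinarith

lemma Solves.smul {ψ φ : L2 V k} (h : Solves G K g W z ψ φ) (a : ℂ) :
    Solves G K g W z (a • ψ) (a • φ) := by
  intro x
  rw [lp.coeFn_smul, lp.coeFn_smul, map_smul, Pi.smul_apply, Pi.smul_apply, Pi.smul_apply, ← h x,
    smul_sub, smul_comm]

lemma Solves.add {ψ φ ψ' φ' : L2 V k} (h : Solves G K g W z ψ φ) (h' : Solves G K g W z ψ' φ') :
    Solves G K g W z (ψ + ψ') (φ + φ') := by
  have := h.sub (h'.smul (-1))
  simpa [sub_neg_eq_add] using this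

lemma IsBoundedHopping.solves_unique (hK : IsBoundedHopping G K κ c)
    (hW : ∀ x, (W x).IsHermitian) (hz : z.im ≠ 0) {ψ ψ' φ : L2 V k}
    (h : Solves G K g W z ψ φ) (h' : Solves G K g W z ψ' φ) : ψ = ψ' := by
  have h1 := hK.norm_le_of_solves hW (h.sub h')
  rw [sub_self, norm_zero] at h1
  have h2 : 0 < |z.im| := abs_pos.2 hz
  have h3 : ‖ψ - ψ'‖ = 0 := le_antisymm (by nlinarith [norm_nonneg (ψ - ψ')]) (norm_nonneg _)
  exact sub_eq_zero.1 (norm_eq_zero.1 h3)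

open Classical in
/-- The image `H (δ_x ⊗ u)`. -/
noncomputable def hamSingle (G : SimpleGraph V) [G.LocallyFinite] (K : V → V → Mat k) (g : ℝ)
    (W : V → Mat k) (x : V) (u : Fib k) : L2 V k :=
  lp.single 2 x (Matrix.toEuclideanLin (W x) u) + ((g⁻¹ : ℝ) : ℂ) • ∑ y ∈ G.neighborFinset x,
    lp.single 2 y (Matrix.toEuclideanLin (K y x) u)

open Classical in
lemma solves_single (x : V) (u : Fib k) : Solves G K g W z (lp.single 2 x u)
    (hamSingle G K g W x u - z • lp.single 2 x u) := by
  intro y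
  rw [lp.coeFn_sub, Pi.sub_apply, lp.coeFn_smul, Pi.smul_apply]
  congr 1
  rw [hamSingle, lp.coeFn_add, Pi.add_apply, lp.coeFn_smul, Pi.smul_apply, lp.coeFn_sum,
    Finset.sum_apply]
  simp only [formalHam, LinearMap.coe_mk, AddHom.coe_mk, lp.coeFn_single]
  congr 1
  · rcases eq_or_ne y x with rfl | h
    · simp
    · simp [h]
  · congr 1
    have h1 : ∀ y', Matrix.toEuclideanLin (K y y') ((Pi.single x u : V → Fib k) y') =
        if y' = x then Matrix.toEuclideanLin (K y x) u else 0 := by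
      intro y'
      rcases eq_or_ne y' x with rfl | h
      · simp
      · simp [h]
    have h2 : ∀ y', (Pi.single y' (Matrix.toEuclideanLin (K y' x) u) : V → Fib k) y =
        if y' = y then Matrix.toEuclideanLin (K y x) u else 0 := by
      intro y'
      rcases eq_or_ne y' y with rfl | h
      · simp
      · simp [h, h.symm]
    simp only [h1, h2, Finset.sum_ite_eq', SimpleGraph.mem_neighborFinset, G.adj_comm]

open Classical in
lemma IsBoundedHopping.inner_hamSingle (hK : IsBoundedHopping G K κ c)
    (hW : ∀ x, (W x).IsHermitian) (x : V) (u : Fib k) (φ : L2 V k) :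
    inner ℂ (hamSingle G K g W x u) φ = inner ℂ u (formalHam G K g W φ x) := by
  rw [hamSingle, inner_add_left, inner_smul_left, sum_inner, lp.inner_single_left]
  simp only [formalHam, LinearMap.coe_mk, AddHom.coe_mk, lp.inner_single_left,
    inner_toEuclideanLin_left, (hW x).eq, inner_add_right, inner_smul_right, inner_sum,
    Complex.conj_ofReal]
  congr 2
  refine Finset.sum_congr rfl fun y hy => ?_
  rw [SimpleGraph.mem_neighborFinset] at hy
  rw [hK.conj x y hy, Matrix.conjTranspose_conjTranspose]

open Classical in
-- Orthogonality to the images of the finitely supported vectors says that Hφ equals conj(z)φ at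
-- every site. Since φ is in ℓ², it then lies in the maximal domain, and uniqueness at the conjugate
-- energy applies.
lemma IsBoundedHopping.eq_zero_of_inner (hK : IsBoundedHopping G K κ c)
    (hW : ∀ x, (W x).IsHermitian) (hz : z.im ≠ 0) {φ : L2 V k}
    (h : ∀ x u, inner ℂ (hamSingle G K g W x u - z • lp.single 2 x u) φ = 0) : φ = 0 := by
  have h1 : Solves G K g W (starRingEnd ℂ z) φ 0 := by
    intro x
    refine ext_inner_left ℂ fun u => ?_
    have := h x u
    rw [inner_sub_left, hK.inner_hamSingle hW, inner_smul_left, lp.inner_single_left] at this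
    rw [inner_sub_right, inner_smul_right, this]
    simp
  have h2 : Solves G K g W (starRingEnd ℂ z) (0 : L2 V k) 0 := by
    simpa using h1.smul 0
  exact hK.solves_unique hW (by simpa using hz) h1 h2

lemma continuous_formalHam_apply (x : V) :
    Continuous fun ψ : L2 V k => formalHam G K g W ψ x := by
  have h : ∀ y, Continuous fun ψ : L2 V k => ψ y := fun y =>
    (lp.evalCLM ℂ (fun _ : V => Fib k) 2 y).continuous
  have h2 : ∀ M : Mat k, Continuous (Matrix.toEuclideanLin M) := fun M =>
    LinearMap.continuous_of_finiteDimensional _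
  simp only [formalHam, LinearMap.coe_mk, AddHom.coe_mk]
  have h3 : Continuous fun ψ : L2 V k =>
      ∑ y ∈ G.neighborFinset x, Matrix.toEuclideanLin (K x y) (ψ y) :=
    continuous_finsetSum _ fun y _ => (h2 _).comp (h y)
  exact ((h2 _).comp (h x)).add (h3.const_smul ((g⁻¹ : ℝ) : ℂ))

lemma isClosed_solves : IsClosed {p : L2 V k × L2 V k | Solves G K g W z p.1 p.2} := by
  simp only [Solves, Set.ofPred_forall]
  have h : ∀ y, Continuous fun ψ : L2 V k => ψ y := fun y =>
    (lp.evalCLM ℂ (fun _ : V => Fib k) 2 y).continuous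
  refine isClosed_iInter fun x => isClosed_eq ?_ ((h x).comp continuous_snd)
  exact ((continuous_formalHam_apply x).comp continuous_fst).sub
    (((h x).comp continuous_fst).const_smul z)

/-- The range of `H - z`. -/
def solvesRange (G : SimpleGraph V) [G.LocallyFinite] (K : V → V → Mat k) (g : ℝ)
    (W : V → Mat k) (z : ℂ) : Submodule ℂ (L2 V k) where
  carrier := {φ | ∃ ψ, Solves G K g W z ψ φ}
  zero_mem' := ⟨0, fun x => by
    change formalHam G K g W 0 x - z • 0 = 0
    rw [map_zero, smul_zero, sub_zero, Pi.zero_apply]⟩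
  add_mem' := by
    rintro φ φ' ⟨ψ, h⟩ ⟨ψ', h'⟩
    exact ⟨_, h.add h'⟩
  smul_mem' := by
    rintro a φ ⟨ψ, h⟩
    exact ⟨_, h.smul a⟩

/-- The a priori bound |Im z|‖ψ‖ ≤ ‖φ‖ makes the range of H - z closed, and a vector orthogonal to
the range is zero. -/
lemma IsBoundedHopping.exists_solves (hK : IsBoundedHopping G K κ c)
    (hW : ∀ x, (W x).IsHermitian) (hz : z.im ≠ 0) (φ : L2 V k) :
    ∃ ψ, Solves G K g W z ψ φ := by
  classical
  have hz' : 0 < |z.im| := abs_pos.2 hz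
  have hclosed : IsClosed (solvesRange G K g W z : Set (L2 V k)) := by
    refine IsSeqClosed.isClosed fun f φ hf hφ => ?_
    choose ψ hψ using hf
    have hc : CauchySeq ψ := by
      have hcf := hφ.cauchySeq
      rw [Metric.cauchySeq_iff] at hcf ⊢
      intro ε hε
      obtain ⟨N, hN⟩ := hcf (|z.im| * ε) (by positivity)
      refine ⟨N, fun m hm n hn => ?_⟩
      have h1 := hN m hm n hn
      rw [dist_eq_norm] at h1 ⊢
      exact lt_of_mul_lt_mul_left
        ((hK.norm_le_of_solves hW ((hψ m).sub (hψ n))).trans_lt h1) hz'.le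
    obtain ⟨ψ0, h0⟩ := cauchySeq_tendsto_of_complete hc
    have hcl : IsClosed {p : L2 V k × L2 V k | Solves G K g W z p.1 p.2} := isClosed_solves
    have hlim : Tendsto (fun n => (ψ n, f n)) atTop (𝓝 (ψ0, φ)) := h0.prodMk_nhds hφ
    have hmem : (ψ0, φ) ∈ {p : L2 V k × L2 V k | Solves G K g W z p.1 p.2} :=
      hcl.mem_of_tendsto hlim (Eventually.of_forall hψ)
    exact ⟨ψ0, hmem⟩
  have htop : solvesRange G K g W z = ⊤ := by
    have hbot : (solvesRange G K g W z)ᗮ = ⊥ := by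
      rw [Submodule.eq_bot_iff]
      intro φ hφ
      have h0 := (Submodule.mem_orthogonal _ φ).1 hφ
      refine hK.eq_zero_of_inner (g := g) hW hz fun x u => h0 _ ?_
      exact ⟨_, solves_single x u⟩
    have := Submodule.topologicalClosure_eq_top_iff.2 hbot
    rwa [hclosed.submodule_topologicalClosure_eq] at this
  have : φ ∈ solvesRange G K g W z := htop ▸ Submodule.mem_top
  exact this

theorem IsBoundedHopping.exists_isResolventAt (hK : IsBoundedHopping G K κ c)
    (hW : ∀ x, (W x).IsHermitian) (hz : z.im ≠ 0) :
    ∃ R, IsResolventAt (hamiltonian G K g W) z R := by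
  choose R hR using fun φ => hK.exists_solves (g := g) hW hz φ
  have hz' : 0 < |z.im| := abs_pos.2 hz
  let L : L2 V k →ₗ[ℂ] L2 V k :=
    { toFun := R
      map_add' := fun φ φ' => hK.solves_unique hW hz (hR _) ((hR φ).add (hR φ'))
      map_smul' := fun a φ => hK.solves_unique hW hz (hR _) ((hR φ).smul a) }
  refine ⟨L.mkContinuous |z.im|⁻¹ fun φ => ?_, fun φ => ⟨(hR φ).memℓp, ?_⟩, fun ψ => ?_⟩
  · rw [inv_mul_eq_div, le_div_iff₀' hz']
    exact hK.norm_le_of_solves hW (hR φ)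
  · apply lp.ext
    funext x
    exact hR φ x
  · refine hK.solves_unique hW hz (hR _) fun x => ?_
    rfl

lemma IsBoundedHopping.isResolventAt (hK : IsBoundedHopping G K κ c)
    (hW : ∀ x, (W x).IsHermitian) (hz : z.im ≠ 0) :
    IsResolventAt (hamiltonian G K g W) z (resolventOp (hamiltonian G K g W) z) := by
  have h := hK.exists_isResolventAt (g := g) hW hz
  rw [resolventOp, dif_pos h]
  exact h.choose_spec

lemma IsBoundedHopping.norm_resolventOp_apply_le (hK : IsBoundedHopping G K κ c)
    (hW : ∀ x, (W x).IsHermitian) (hz : z.im ≠ 0) (φ : L2 V k) :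
    |z.im| * ‖resolventOp (hamiltonian G K g W) z φ‖ ≤ ‖φ‖ :=
  hK.norm_le_of_solves hW ((hK.isResolventAt hW hz).solves φ)

end Operator

/-! ### Dependence of the resolvent on the potential and on the energy -/

section Resolvent

variable {V : Type u} {k : ℕ} {G : SimpleGraph V} [G.LocallyFinite] {K : V → V → Mat k}
  {κ : ℕ} {c g : ℝ} {W : V → Mat k} {z : ℂ}

lemma IsBoundedHopping.lipschitzWith_resolventOp (hK : IsBoundedHopping G K κ c)
    (hW : ∀ x, (W x).IsHermitian) (hz : z.im ≠ 0) :
    LipschitzWith |z.im|⁻¹.toNNReal (resolventOp (hamiltonian G K g W) z) := by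
  refine LipschitzWith.of_dist_le_mul fun φ φ' => ?_
  have hz' : 0 < |z.im| := abs_pos.2 hz
  rw [dist_eq_norm, dist_eq_norm, ← map_sub, Real.coe_toNNReal _ (by positivity), inv_mul_eq_div,
    le_div_iff₀' hz']
  exact hK.norm_resolventOp_apply_le hW hz _

/-- Strong resolvent continuity under sitewise convergence of the potentials, without any uniformity
in the site; it later yields measurability. The common Lipschitz constant 1/|Im z| makes the set of
vectors with convergent images closed, so a total family suffices. -/
theorem IsBoundedHopping.continuous_resolventOp {T : Type*} [TopologicalSpace T]
    (hK : IsBoundedHopping G K κ c) {Wf : T → V → Mat k} (hW : ∀ t x, (Wf t x).IsHermitian)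
    (hc : ∀ x, Continuous fun t => Wf t x) (hz : z.im ≠ 0) (φ : L2 V k) :
    Continuous fun t => resolventOp (hamiltonian G K g (Wf t)) z φ := by
  classical
  rw [continuous_iff_continuousAt]
  intro t0
  set R : T → L2 V k →L[ℂ] L2 V k := fun t => resolventOp (hamiltonian G K g (Wf t)) z with hR
  let S : Submodule ℂ (L2 V k) :=
    { carrier := {φ | Tendsto (fun t => R t φ) (𝓝 t0) (𝓝 (R t0 φ))}
      zero_mem' := by simp
      add_mem' := fun {a b} ha hb => by
        simp only [Set.mem_ofPred_eq, map_add] at ha hb ⊢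
        exact ha.add hb
      smul_mem' := fun a b hb => by
        simp only [Set.mem_ofPred_eq, map_smul] at hb ⊢
        exact hb.const_smul a }
  have hcl : IsClosed (S : Set (L2 V k)) :=
    (LipschitzWith.uniformEquicontinuous (fun t => (R t : L2 V k → L2 V k)) |z.im|⁻¹.toNNReal
      fun t => hK.lipschitzWith_resolventOp (hW t) hz).equicontinuous.isClosed_setOfPred_tendsto
      (R t0).continuous
  have hmem : ∀ x u, hamSingle G K g (Wf t0) x u - z • lp.single 2 x u ∈ S := by
    intro x u
    change Tendsto (fun t => R t _) _ _
    -- On δ_x ⊗ u the Hamiltonians at t and t0 differ only through the potential at x.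
    have h1 : ∀ t, R t (hamSingle G K g (Wf t0) x u - z • lp.single 2 x u) - lp.single 2 x u =
        R t (lp.single 2 x (Matrix.toEuclideanLin (Wf t0 x - Wf t x) u)) := by
      intro t
      have h2 : R t (hamSingle G K g (Wf t) x u - z • lp.single 2 x u) = lp.single 2 x u :=
        (solves_single x u).eq_of_isResolventAt (hK.isResolventAt (hW t) hz)
      rw [← h2, ← map_sub, h2]
      congr 1
      simp only [hamSingle, map_sub, LinearMap.sub_apply, lp.single_sub]
      abel
    have h0 : R t0 (hamSingle G K g (Wf t0) x u - z • lp.single 2 x u) = lp.single 2 x u :=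
      (solves_single x u).eq_of_isResolventAt (hK.isResolventAt (hW t0) hz)
    rw [h0, tendsto_iff_norm_sub_tendsto_zero]
    have hz' : 0 < |z.im| := abs_pos.2 hz
    have hlim : Tendsto (fun t => |z.im|⁻¹ * (‖Wf t0 x - Wf t x‖ * ‖u‖)) (𝓝 t0) (𝓝 0) := by
      have : Tendsto (fun t => ‖Wf t0 x - Wf t x‖) (𝓝 t0) (𝓝 0) := by
        have h := ((hc x).tendsto t0).const_sub (Wf t0 x)
        rw [sub_self] at h
        simpa using h.norm
      simpa using (this.mul_const ‖u‖).const_mul |z.im|⁻¹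
    refine squeeze_zero (fun t => norm_nonneg _) (fun t => ?_) hlim
    rw [h1, inv_mul_eq_div, le_div_iff₀' hz']
    refine (hK.norm_resolventOp_apply_le (hW t) hz _).trans ?_
    rw [lp.norm_single (by norm_num)]
    exact norm_toEuclideanLin_le _ _
  have hbot : Sᗮ = ⊥ := by
    rw [Submodule.eq_bot_iff]
    intro φ hφ
    have h0 := (Submodule.mem_orthogonal _ φ).1 hφ
    refine hK.eq_zero_of_inner (g := g) (hW t0) hz fun x u => h0 _ (hmem x u)
  have htop := Submodule.topologicalClosure_eq_top_iff.2 hbot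
  rw [hcl.submodule_topologicalClosure_eq] at htop
  have : φ ∈ S := htop ▸ Submodule.mem_top
  exact this

/-- The difference ψ' - ψ solves the equation at λ + iε' with right side i(ε' - ε)ψ. The
imaginary-part identity then forces Re⟨ψ' - ψ, ψ⟩ ≥ 0, and expanding ‖(ψ' - ψ) + ψ‖² gives the
bound. Monotonicity of the norm and the Cauchy property both follow from it. -/
lemma IsBoundedHopping.norm_sub_sq_le (hK : IsBoundedHopping G K κ c)
    (hW : ∀ x, (W x).IsHermitian) {lam ε ε' : ℝ} (hε' : 0 < ε') (hε : ε' ≤ ε)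
    {φ ψ ψ' : L2 V k} (h : Solves G K g W (lam + ε * Complex.I) ψ φ)
    (h' : Solves G K g W (lam + ε' * Complex.I) ψ' φ) :
    ‖ψ' - ψ‖ ^ 2 ≤ ‖ψ'‖ ^ 2 - ‖ψ‖ ^ 2 := by
  rcases hε.eq_or_lt with rfl | hlt
  · rw [hK.solves_unique hW (by simpa using hε'.ne') h h']
    simp
  have h1 := h'.sub (h.shift (lam + ε' * Complex.I))
  have h2 := hK.im_inner_eq hW h1
  have h3 : φ - (φ + ((lam + ε * Complex.I : ℂ) - (lam + ε' * Complex.I)) • ψ) =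
      (((ε' - ε : ℝ) : ℂ) * Complex.I) • ψ := by
    rw [sub_add_cancel_left, ← neg_smul]
    congr 1
    push_cast
    ring
  rw [h3, inner_smul_right] at h2
  have h4 : (ε' - ε) * (inner ℂ (ψ' - ψ) ψ : ℂ).re = - ε' * ‖ψ' - ψ‖ ^ 2 := by
    have : ((((ε' - ε : ℝ) : ℂ) * Complex.I) * (inner ℂ (ψ' - ψ) ψ : ℂ)).im =
        (ε' - ε) * (inner ℂ (ψ' - ψ) ψ : ℂ).re := by
      simp [Complex.mul_im, Complex.mul_re]
    rw [← this, h2]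
    simp
  have h5 : 0 ≤ (inner ℂ (ψ' - ψ) ψ : ℂ).re := by
    nlinarith [sq_nonneg ‖ψ' - ψ‖, mul_nonneg hε'.le (sq_nonneg ‖ψ' - ψ‖)]
  have h6 := norm_add_sq (𝕜 := ℂ) (ψ' - ψ) ψ
  rw [sub_add_cancel] at h6
  have h7 : RCLike.re (inner ℂ (ψ' - ψ) ψ : ℂ) = (inner ℂ (ψ' - ψ) ψ : ℂ).re := rfl
  rw [h7] at h6
  linarith

/-- The vector `G_{λ+iε} φ`. -/
noncomputable def boundaryFamily (G : SimpleGraph V) [G.LocallyFinite] (K : V → V → Mat k) (g : ℝ)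
    (W : V → Mat k) (lam : ℝ) (φ : L2 V k) (ε : ℝ) : L2 V k :=
  resolventOp (hamiltonian G K g W) (lam + ε * Complex.I) φ

lemma IsBoundedHopping.solves_boundaryFamily (hK : IsBoundedHopping G K κ c)
    (hW : ∀ x, (W x).IsHermitian) (lam : ℝ) (φ : L2 V k) {ε : ℝ} (hε : 0 < ε) :
    Solves G K g W (lam + ε * Complex.I) (boundaryFamily G K g W lam φ ε) φ :=
  (hK.isResolventAt hW (by simpa using hε.ne')).solves φ

lemma IsBoundedHopping.norm_boundaryFamily_anti (hK : IsBoundedHopping G K κ c)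
    (hW : ∀ x, (W x).IsHermitian) (lam : ℝ) (φ : L2 V k) {ε ε' : ℝ} (hε' : 0 < ε') (h : ε' ≤ ε) :
    ‖boundaryFamily G K g W lam φ ε‖ ≤ ‖boundaryFamily G K g W lam φ ε'‖ := by
  have := hK.norm_sub_sq_le hW hε' h (hK.solves_boundaryFamily hW lam φ (hε'.trans_le h))
    (hK.solves_boundaryFamily (g := g) hW lam φ hε')
  refine le_of_sq_le_sq ?_ (norm_nonneg _)
  nlinarith [sq_nonneg ‖boundaryFamily G K g W lam φ ε' - boundaryFamily G K g W lam φ ε‖]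

lemma IsBoundedHopping.exists_tendsto_boundaryFamily (hK : IsBoundedHopping G K κ c)
    (hW : ∀ x, (W x).IsHermitian) (lam : ℝ) (φ : L2 V k) {M : ℝ}
    (hM : ∀ ε, 0 < ε → ‖boundaryFamily G K g W lam φ ε‖ ≤ M) :
    ∃ ψ, Tendsto (boundaryFamily G K g W lam φ) (𝓝[>] 0) (𝓝 ψ) := by
  set ψ := boundaryFamily G K g W lam φ with hψ
  set F : Set ℝ := (fun ε => ‖ψ ε‖ ^ 2) '' Set.Ioi 0 with hF
  have hne : F.Nonempty := ⟨_, 1, Set.mem_Ioi.2 one_pos, rfl⟩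
  have hbdd : BddAbove F := by
    refine ⟨M ^ 2, ?_⟩
    rintro _ ⟨ε, hε, rfl⟩
    exact pow_le_pow_left₀ (norm_nonneg _) (hM ε hε) 2
  refine CompleteSpace.complete (f := map ψ (𝓝[>] 0)) (Metric.cauchy_iff.2 ⟨inferInstance, ?_⟩)
  intro δ hδ
  -- Past an ε0 at which the monotone quantity ‖ψ ε‖² is within (δ/2)² of its supremum, all vectors
  -- stay within δ/2 of ψ ε0.
  obtain ⟨_, ⟨ε0, hε0, rfl⟩, h0⟩ := exists_lt_of_lt_csSup hne
    (show sSup F - (δ / 2) ^ 2 < sSup F by nlinarith [sq_nonneg (δ / 2), show 0 < (δ/2)^2 by positivity])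
  have key : ∀ ε ∈ Set.Ioc 0 ε0, dist (ψ ε) (ψ ε0) < δ / 2 := by
    intro ε hε
    have h1 := hK.norm_sub_sq_le hW hε.1 hε.2 (hK.solves_boundaryFamily hW lam φ hε0)
      (hK.solves_boundaryFamily (g := g) hW lam φ hε.1)
    have h2 : ‖ψ ε‖ ^ 2 ≤ sSup F := le_csSup hbdd ⟨ε, hε.1, rfl⟩
    rw [dist_eq_norm]
    refine lt_of_pow_lt_pow_left₀ 2 (by positivity) (h1.trans_lt ?_)
    simp only at h0
    linarith
  refine ⟨ψ '' Set.Ioc 0 ε0, image_mem_map (Ioc_mem_nhdsGT hε0), ?_⟩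
  rintro _ ⟨a, ha, rfl⟩ _ ⟨b, hb, rfl⟩
  have := dist_triangle_right (ψ a) (ψ b) (ψ ε0)
  linarith [key a ha, key b hb]

end Resolvent

/-! ### Equations for the matrix elements and their rational dependence on one site -/

section Kernel

variable {V : Type u} {k : ℕ} {G : SimpleGraph V} [G.LocallyFinite] {K : V → V → Mat k}
  {κ : ℕ} {c g : ℝ} {W : V → Mat k} {z : ℂ}

lemma toEuclideanLin_single (M : Mat k) (i j : Fin k) :
    (Matrix.toEuclideanLin M (EuclideanSpace.single j 1)) i = M i j := by
  simp

lemma mat_ext {M N : Mat k} (h : ∀ u, Matrix.toEuclideanLin M u = Matrix.toEuclideanLin N u) :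
    M = N :=
  Matrix.toEuclideanLin.injective (LinearMap.ext h)

lemma toEuclideanLin_mul_apply (M N : Mat k) (u : Fib k) :
    Matrix.toEuclideanLin (M * N) u = Matrix.toEuclideanLin M (Matrix.toEuclideanLin N u) := by
  simp [Matrix.toLpLin_apply, Matrix.mulVec_mulVec]

open Classical in
lemma kernelAt_apply (T : L2 V k →L[ℂ] L2 V k) (x y : V) (u : Fib k) :
    Matrix.toEuclideanLin (kernelAt T x y) u = T (lp.single 2 y u) x := by
  have h : Matrix.toEuclideanLin (kernelAt T x y) =
      ((lp.evalCLM ℂ (fun _ : V => Fib k) 2 x).toLinearMap ∘ₗ T.toLinearMap ∘ₗ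
        (lp.singleContinuousLinearMap ℂ (fun _ : V => Fib k) 2 y).toLinearMap) := by
    refine (EuclideanSpace.basisFun (Fin k) ℂ).toBasis.ext fun j => ?_
    ext i
    rw [OrthonormalBasis.coe_toBasis, EuclideanSpace.basisFun_apply, toEuclideanLin_single]
    rfl
  rw [h]
  rfl

open Classical in
lemma IsBoundedHopping.green_eq (hK : IsBoundedHopping G K κ c)
    (hW : ∀ x, (W x).IsHermitian) (hz : z.im ≠ 0) (x y : V) :
    (W x - z • 1) * green G K g W z x y + ((g⁻¹ : ℝ) : ℂ) • ∑ u ∈ G.neighborFinset x,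
      K x u * green G K g W z u y = if x = y then 1 else 0 := by
  refine mat_ext fun u => ?_
  have h := (hK.isResolventAt (g := g) hW hz).solves (lp.single 2 y u) x
  simp only [green, map_add, map_smul, map_sum, LinearMap.add_apply, LinearMap.smul_apply,
    LinearMap.sum_apply, toEuclideanLin_mul_apply, kernelAt_apply, map_sub, LinearMap.sub_apply]
  have h1 : ∀ v : Fib k, Matrix.toEuclideanLin (1 : Mat k) v = v := fun v => by simp
  rw [h1]
  simp only [formalHam, LinearMap.coe_mk, AddHom.coe_mk] at h
  rw [sub_add_eq_add_sub, h]
  rcases eq_or_ne x y with rfl | hxy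
  · simp
  · simp [hxy]

open Classical in
-- Second resolvent identity for a perturbation supported at the single site x: only G(x,x) and
-- G(x,y) enter, so the equation closes.
lemma IsBoundedHopping.green_perturb (hK : IsBoundedHopping G K κ c) {W' : V → Mat k}
    (hW : ∀ x, (W x).IsHermitian) (hW' : ∀ x, (W' x).IsHermitian) (hz : z.im ≠ 0) {x : V}
    {M : Mat k} (hx : W' x = W x + M) (hne : ∀ y, y ≠ x → W' y = W y) (y : V) :
    green G K g W' z x y + green G K g W z x x * M * green G K g W' z x y =
      green G K g W z x y := by
  refine mat_ext fun u => ?_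
  set φ : L2 V k := lp.single 2 y u with hφ
  set ψ := resolventOp (hamiltonian G K g W') z φ with hψ
  have h := (hK.isResolventAt (g := g) hW' hz).solves φ
  have h1 : Solves G K g W z ψ (φ - lp.single 2 x (Matrix.toEuclideanLin M (ψ x))) := by
    intro y'
    rw [lp.coeFn_sub, Pi.sub_apply, ← h y']
    rcases eq_or_ne y' x with rfl | hy
    · simp only [formalHam, LinearMap.coe_mk, AddHom.coe_mk, hx, map_add, LinearMap.add_apply,
        lp.coeFn_single, Pi.single_eq_same]
      abel
    · simp [formalHam, LinearMap.coe_mk, AddHom.coe_mk, hne y' hy, hy, hψ]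
  have h2 := h1.eq_of_isResolventAt (hK.isResolventAt hW hz)
  rw [map_sub, sub_eq_iff_eq_add] at h2
  have h3 := congrArg (fun f : L2 V k => (f : V → Fib k) x) h2
  simp only [lp.coeFn_add, Pi.add_apply] at h3
  simp only [green, map_add, LinearMap.add_apply, toEuclideanLin_mul_apply, kernelAt_apply]
  exact h3.symm

/-- The perturbed Green function supplies an explicit inverse of 1 + G(x,x)M, namely 1 - G'(x,x)M.
-/
lemma IsBoundedHopping.isUnit_det_one_add (hK : IsBoundedHopping G K κ c) {W' : V → Mat k}
    (hW : ∀ x, (W x).IsHermitian) (hW' : ∀ x, (W' x).IsHermitian) (hz : z.im ≠ 0) {x : V}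
    {M : Mat k} (hx : W' x = W x + M) (hne : ∀ y, y ≠ x → W' y = W y) :
    (1 + green G K g W z x x * M).det ≠ 0 := by
  have h := hK.green_perturb (g := g) hW hW' hz hx hne x
  have h1 : (1 + green G K g W z x x * M) * (1 - green G K g W' z x x * M) = 1 := by
    have : (1 + green G K g W z x x * M) * (1 - green G K g W' z x x * M) = 1 +
        (green G K g W z x x - (green G K g W' z x x +
          green G K g W z x x * M * green G K g W' z x x)) * M := by noncomm_ring
    rw [this, h, sub_self, zero_mul, add_zero]
  intro h0
  have := congrArg Matrix.det h1
  rw [Matrix.det_mul, h0, zero_mul, Matrix.det_one] at this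
  exact zero_ne_one this

open Polynomial in
-- Cramer's rule. The entries of the adjugate of a linear pencil are signed minors of size n, hence
-- of degree one below the bound for the determinant; this one degree later gives the strict
-- inequality between the exponents.
lemma exists_polynomial_of_linear_pencil {n : ℕ} (N F : Mat (n + 1)) :
    ∃ (p : Fin (n + 1) → Fin (n + 1) → ℂ[X]) (Q : ℂ[X]), (∀ i j, (p i j).natDegree ≤ n) ∧
      Q.natDegree ≤ n + 1 ∧ (∀ t, Q.eval t = (1 + t • N).det) ∧
      ∀ (t : ℂ) (X : Mat (n + 1)), (1 + t • N).det ≠ 0 → (1 + t • N) * X = F →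
        ∀ i j, X i j = (p i j).eval t / Q.eval t := by
  set P : Matrix (Fin (n + 1)) (Fin (n + 1)) ℂ[X] := (X : ℂ[X]) • N.map C + (1 : Mat (n + 1)).map C
    with hP
  have hPe : ∀ t : ℂ, (evalRingHom t).mapMatrix P = 1 + t • N := by
    intro t
    ext i j
    have h1 : (1 : Matrix (Fin (n + 1)) (Fin (n + 1)) ℂ[X]) i j = C ((1 : Mat (n + 1)) i j) := by
      rw [Matrix.one_apply, Matrix.one_apply]
      split_ifs <;> simp
    simp [hP, h1]
    ring
  have hQ : ∀ t, P.det.eval t = (1 + t • N).det := by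
    intro t
    rw [← hPe, ← RingHom.map_det]
    rfl
  refine ⟨fun i j => ∑ l, P.adjugate i l * C (F l j), P.det, fun i j => ?_, ?_, hQ, ?_⟩
  · refine natDegree_sum_le_of_forall_le _ _ fun l _ => ?_
    refine (natDegree_mul_C_le _ _).trans ?_
    rw [Matrix.adjugate_fin_succ_eq_det_submatrix]
    have h1 : P.submatrix l.succAbove i.succAbove =
        (X : ℂ[X]) • (N.submatrix l.succAbove i.succAbove).map C +
          ((1 : Mat (n + 1)).submatrix l.succAbove i.succAbove).map C := rfl
    have h2 : ((-1 : ℂ[X]) ^ ((l : ℕ) + (i : ℕ))) = C ((-1) ^ ((l : ℕ) + (i : ℕ))) := by simp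
    rw [h1, h2]
    refine (natDegree_C_mul_le _ _).trans ((natDegree_det_X_add_C_le _ _).trans ?_)
    simp
  · refine (natDegree_det_X_add_C_le _ _).trans ?_
    simp
  · intro t Y h0 hY i j
    rw [eq_div_iff (by rwa [hQ]), hQ]
    have h1 : (1 + t • N).adjugate * F = (1 + t • N).det • Y := by
      rw [← hY, ← Matrix.mul_assoc, Matrix.adjugate_mul, Matrix.smul_mul, Matrix.one_mul]
    have h2 := congrFun (congrFun h1 i) j
    rw [Matrix.smul_apply, smul_eq_mul] at h2
    rw [mul_comm, ← h2, Matrix.mul_apply, eval_finsetSum]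
    refine Finset.sum_congr rfl fun l _ => ?_
    rw [eval_mul, eval_C, ← hPe, ← RingHom.map_adjugate]
    rfl

end Kernel

/-! ### Estimates uniform over the admissible single-site laws -/

section Distribution

lemma HasMomentBound.exists_tail_le {q C : ℝ} (hq : 0 < q) {η : ℝ} (hη : 0 < η) :
    ∃ R : ℝ, 0 < R ∧ ∀ μ : Measure ℝ, HasMomentBound μ q C →
      μ {t | R < |t|} ≤ ENNReal.ofReal η := by
  -- Markov's inequality with R^q = |C|/η + 1, which ensures C ≤ R^q η.
  refine ⟨(|C| / η + 1) ^ (1 / q), by positivity, fun μ h => ?_⟩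
  set R := (|C| / η + 1) ^ (1 / q) with hR
  have hR0 : 0 < R := by positivity
  have hRq : R ^ q = |C| / η + 1 := by
    rw [hR, ← Real.rpow_mul (by positivity), one_div_mul_cancel hq.ne', Real.rpow_one]
  have h1 : ENNReal.ofReal (R ^ q) * μ {t | R < |t|} ≤ ENNReal.ofReal C := by
    refine le_trans ?_ ((mul_meas_ge_le_lintegral (μ := μ)
      (f := fun t : ℝ => ENNReal.ofReal (|t| ^ q)) (by fun_prop) (ENNReal.ofReal (R ^ q))).trans h)
    gcongr
    intro ht
    exact ENNReal.ofReal_le_ofReal (Real.rpow_le_rpow hR0.le (le_of_lt ht) hq.le)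
  have h2 : C ≤ R ^ q * η := by
    rw [hRq, add_mul, div_mul_cancel₀ _ hη.ne']
    linarith [le_abs_self C]
  have h3 := h1.trans (ENNReal.ofReal_le_ofReal h2)
  rw [ENNReal.ofReal_mul (by positivity)] at h3
  exact (ENNReal.mul_le_mul_iff_right (by simp; positivity) ENNReal.ofReal_ne_top).1 h3

/-- The distance from a real point to b is at least its distance to Re b, so complex roots are no
worse than real ones. -/
lemma IsAlphaRegular.measure_ball_le {μ : Measure ℝ} {α C : ℝ} (h : IsAlphaRegular μ α C) (b : ℂ)
    {δ : ℝ} (hδ : 0 < δ) : μ {t : ℝ | ‖(t : ℂ) - b‖ ≤ δ} ≤ ENNReal.ofReal (C * δ ^ α) := by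
  refine (measure_mono fun t ht => ?_).trans (h b.re δ hδ)
  have h1 : |t - b.re| ≤ δ := by
    have := (Complex.abs_re_le_norm ((t : ℂ) - b)).trans ht
    simpa using this
  rw [abs_le] at h1
  exact ⟨by linarith, by linarith⟩

lemma IsAlphaRegular.exists_ball_le {α C : ℝ} (hα : 0 < α) {η : ℝ} (hη : 0 < η) :
    ∃ δ : ℝ, 0 < δ ∧ ∀ μ : Measure ℝ, IsAlphaRegular μ α C → ∀ b : ℂ,
      μ {t : ℝ | ‖(t : ℂ) - b‖ ≤ δ} ≤ ENNReal.ofReal η := by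
  refine ⟨(η / (|C| + 1)) ^ (1 / α), by positivity, fun μ h b => ?_⟩
  refine (h.measure_ball_le b (by positivity)).trans (ENNReal.ofReal_le_ofReal ?_)
  rw [← Real.rpow_mul (by positivity), one_div_mul_cancel hα.ne', Real.rpow_one,
    mul_div_assoc', div_le_iff₀ (by positivity)]
  nlinarith [le_abs_self C]

lemma HasMomentBound.exists_lintegral_one_add_le {q C : ℝ} (hq : 0 < q) :
    ∃ M : ℝ, 0 ≤ M ∧ ∀ μ : Measure ℝ, IsProbabilityMeasure μ → HasMomentBound μ q C →
      ∫⁻ t, ENNReal.ofReal ((1 + |t|) ^ q) ∂μ ≤ ENNReal.ofReal M := by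
  refine ⟨2 ^ q * (1 + |C|), by positivity, fun μ _ h => ?_⟩
  have h1 : ∀ t : ℝ, ENNReal.ofReal ((1 + |t|) ^ q) ≤
      ENNReal.ofReal (2 ^ q) * (1 + ENNReal.ofReal (|t| ^ q)) := by
    intro t
    rw [← ENNReal.ofReal_one, ← ENNReal.ofReal_add (by positivity) (by positivity),
      ← ENNReal.ofReal_mul (by positivity)]
    refine ENNReal.ofReal_le_ofReal ?_
    have h2 : 1 + |t| ≤ 2 * max 1 |t| := by linarith [le_max_left 1 |t|, le_max_right 1 |t|]
    calc (1 + |t|) ^ q ≤ (2 * max 1 |t|) ^ q := by gcongr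
      _ = 2 ^ q * (max 1 |t|) ^ q := Real.mul_rpow (by positivity) (by positivity)
      _ ≤ 2 ^ q * (1 + |t| ^ q) := by
        gcongr
        rcases max_cases 1 |t| with ⟨h, _⟩ | ⟨h, _⟩ <;> rw [h]
        · rw [Real.one_rpow]; linarith [show 0 ≤ |t| ^ q by positivity]
        · linarith
  calc ∫⁻ t, ENNReal.ofReal ((1 + |t|) ^ q) ∂μ
      ≤ ∫⁻ t, ENNReal.ofReal (2 ^ q) * (1 + ENNReal.ofReal (|t| ^ q)) ∂μ := lintegral_mono h1
    _ = ENNReal.ofReal (2 ^ q) * (1 + ∫⁻ t, ENNReal.ofReal (|t| ^ q) ∂μ) := by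
      rw [lintegral_const_mul _ (by fun_prop), lintegral_add_left (by fun_prop), lintegral_const,
        measure_univ, mul_one]
    _ ≤ ENNReal.ofReal (2 ^ q) * (ENNReal.ofReal 1 + ENNReal.ofReal |C|) := by
      rw [ENNReal.ofReal_one]
      gcongr
      exact h.trans (ENNReal.ofReal_le_ofReal (le_abs_self C))
    _ = _ := by
      rw [← ENNReal.ofReal_add (by positivity) (by positivity), ENNReal.ofReal_mul (by positivity)]

/-- Dyadic layers: if 2^{-(n+1)} < r ≤ 2^{-n}, then 1 + 1/r ≤ 2^{n+2}. At r = 0 the convention 1/0 =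
0 applies and the first term suffices. -/
lemma rpow_one_add_inv_le_tsum {β : ℝ} (hβ : 0 < β) (r : ℝ) (hr : 0 ≤ r) :
    ENNReal.ofReal ((1 + 1 / r) ^ β) ≤ ENNReal.ofReal (2 ^ β) +
      ∑' n : ℕ, if r ≤ (1 / 2) ^ n then ENNReal.ofReal ((2 ^ β) ^ (n + 2)) else 0 := by
  rcases hr.eq_or_lt with rfl | hr
  · refine le_add_right (ENNReal.ofReal_le_ofReal ?_)
    gcongr
    norm_num
  rcases le_or_gt r 1 with h1 | h1
  · obtain ⟨n, hn, hn'⟩ := exists_nat_pow_near_of_lt_one hr h1 (show (0 : ℝ) < 1 / 2 by norm_num)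
      (by norm_num)
    refine le_add_left (le_trans ?_ (ENNReal.le_tsum n))
    rw [if_pos hn']
    refine ENNReal.ofReal_le_ofReal ?_
    rw [← Real.rpow_natCast, ← Real.rpow_mul (by norm_num), mul_comm β,
      Real.rpow_mul (by norm_num), Real.rpow_natCast]
    gcongr
    have h2 : 1 / r ≤ 2 ^ (n + 1) := by
      rw [div_le_iff₀ hr]
      have : (2 : ℝ) ^ (n + 1) * (1 / 2) ^ (n + 1) = 1 := by rw [← mul_pow]; norm_num
      nlinarith [show (0 : ℝ) < 2 ^ (n + 1) by positivity]
    have h3 : (1 : ℝ) ≤ 2 ^ (n + 1) := one_le_pow₀ (by norm_num)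
    rw [pow_succ _ (n + 1)]
    linarith
  · refine le_add_right (ENNReal.ofReal_le_ofReal ?_)
    gcongr
    rw [← one_add_one_eq_two]
    gcongr
    exact (div_le_one hr).2 h1.le

/-- The n-th dyadic layer around b has mass at most |C|2^{-αn} and weight of order 2^{βn}, so the
series is geometric with ratio 2^{β-α} < 1. -/
lemma IsAlphaRegular.exists_lintegral_inv_le {α β C : ℝ} (hβ : 0 < β) (hβα : β < α) :
    ∃ M : ℝ, 0 ≤ M ∧ ∀ μ : Measure ℝ, IsProbabilityMeasure μ → IsAlphaRegular μ α C → ∀ b : ℂ,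
      ∫⁻ t : ℝ, ENNReal.ofReal ((1 + 1 / ‖(t : ℂ) - b‖) ^ β) ∂μ ≤ ENNReal.ofReal M := by
  set a : ℕ → ℝ := fun n => (2 ^ β) ^ (n + 2) * (|C| * ((1 / 2) ^ n) ^ α) with ha
  have ha0 : ∀ n, 0 ≤ a n := fun n => by positivity
  have hratio : (2 : ℝ) ^ (β - α) < 1 := Real.rpow_lt_one_of_one_lt_of_neg (by norm_num) (by linarith)
  have has : Summable a := by
    have : a = fun n => (2 ^ β) ^ 2 * |C| * ((2 : ℝ) ^ (β - α)) ^ n := by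
      funext n
      have h1 : (((1 : ℝ) / 2) ^ n) ^ α = (((2 : ℝ) ^ (-α))) ^ n := by
        rw [← Real.rpow_natCast, ← Real.rpow_mul (by norm_num), mul_comm,
          Real.rpow_mul (by norm_num), Real.rpow_natCast, one_div, Real.inv_rpow (by norm_num),
          Real.rpow_neg (by norm_num)]
      simp only [ha]
      rw [h1, sub_eq_add_neg, Real.rpow_add (by norm_num), mul_pow, pow_add]
      ring
    rw [this]
    exact (summable_geometric_of_lt_one (by positivity) hratio).mul_left _
  refine ⟨2 ^ β + ∑' n, a n, add_nonneg (by positivity) (tsum_nonneg ha0), fun μ _ h b => ?_⟩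
  have hmeas : ∀ r : ℝ, MeasurableSet {t : ℝ | ‖(t : ℂ) - b‖ ≤ r} := fun r =>
    measurableSet_le (by fun_prop) measurable_const
  have hm : ∀ n : ℕ, Measurable fun t : ℝ => if ‖(t : ℂ) - b‖ ≤ (1 / 2) ^ n then
      ENNReal.ofReal ((2 ^ β) ^ (n + 2)) else 0 := fun n =>
    Measurable.ite (hmeas _) measurable_const measurable_const
  calc ∫⁻ t : ℝ, ENNReal.ofReal ((1 + 1 / ‖(t : ℂ) - b‖) ^ β) ∂μ
      ≤ ∫⁻ t : ℝ, (ENNReal.ofReal (2 ^ β) + ∑' n : ℕ, if ‖(t : ℂ) - b‖ ≤ (1 / 2) ^ n then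
          ENNReal.ofReal ((2 ^ β) ^ (n + 2)) else 0) ∂μ :=
        lintegral_mono fun t => rpow_one_add_inv_le_tsum hβ _ (norm_nonneg _)
    _ = ENNReal.ofReal (2 ^ β) + ∑' n : ℕ, ENNReal.ofReal ((2 ^ β) ^ (n + 2)) *
          μ {t : ℝ | ‖(t : ℂ) - b‖ ≤ (1 / 2) ^ n} := by
        rw [lintegral_add_left measurable_const, lintegral_const, measure_univ, mul_one,
          lintegral_tsum fun n => (hm n).aemeasurable]
        congr 2
        funext n
        rw [← lintegral_indicator_const (hmeas _)]
        rfl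
    _ ≤ ENNReal.ofReal (2 ^ β) + ∑' n : ℕ, ENNReal.ofReal (a n) := by
        gcongr with n
        rw [ha, ENNReal.ofReal_mul (by positivity)]
        gcongr
        refine (h.measure_ball_le b (by positivity)).trans (ENNReal.ofReal_le_ofReal ?_)
        gcongr
        exact le_abs_self C
    _ = _ := by
        rw [← ENNReal.ofReal_tsum_of_nonneg ha0 has,
          ENNReal.ofReal_add (by positivity) (tsum_nonneg ha0)]

/-- If α > 1, covering a unit interval by n + 1 intervals of radius 1/(n + 1) bounds its mass by
|C|(n + 1)^{1-α}, which tends to 0; the whole line would then be null. With s < α this supplies s ≤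
1, hence subadditivity of r ↦ r^s. -/
lemma IsAlphaRegular.exponent_le_one {μ : Measure ℝ} [IsProbabilityMeasure μ] {α C : ℝ}
    (h : IsAlphaRegular μ α C) : α ≤ 1 := by
  by_contra! hα
  have hcell : ∀ m : ℤ, μ (Set.Icc (m : ℝ) (m + 1)) = 0 := by
    intro m
    have hbound : ∀ n : ℕ, μ (Set.Icc (m : ℝ) (m + 1)) ≤
        ENNReal.ofReal (|C| * ((n : ℝ) + 1) ^ (1 - α)) := by
      intro n
      have hn : (0 : ℝ) < n + 1 := by positivity
      have hcov : Set.Icc (m : ℝ) (m + 1) ⊆ ⋃ i ∈ Finset.range (n + 1),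
          Set.Icc ((m + (i : ℝ) / (n + 1)) - 1 / (n + 1)) ((m + (i : ℝ) / (n + 1)) + 1 / (n + 1)) := by
        intro t ht
        rw [Set.mem_iUnion₂]
        -- At the right endpoint the floor would be n + 1, outside the index range, so the last
        -- interval is used instead.
        rcases ht.2.eq_or_lt with h1 | h1
        · refine ⟨n, by simp, ?_⟩
          rw [h1]
          have : (n : ℝ) / (n + 1) = 1 - 1 / (n + 1) := by field_simp; ring
          rw [this]
          constructor <;> linarith [show 0 < 1 / ((n : ℝ) + 1) by positivity]
        · have h2 : 0 ≤ (t - m) * (n + 1) := mul_nonneg (by linarith [ht.1]) hn.le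
          refine ⟨⌊(t - m) * (n + 1)⌋₊, ?_, ?_⟩
          · rw [Finset.mem_range, Nat.floor_lt h2]
            push_cast
            nlinarith
          · have h3 := Nat.floor_le h2
            have h4 := Nat.lt_floor_add_one ((t - m) * (n + 1))
            set j := (⌊(t - m) * (n + 1)⌋₊ : ℝ)
            have h5 : j / (n + 1) ≤ t - m := by rwa [div_le_iff₀ hn]
            have h6 : t - m ≤ j / (n + 1) + 1 / (n + 1) := by
              rw [← add_div, le_div_iff₀ hn]; exact h4.le
            constructor <;> linarith [show 0 < 1 / ((n : ℝ) + 1) by positivity]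
      refine (measure_mono hcov).trans ((measure_biUnion_finset_le _ _).trans ?_)
      refine (Finset.sum_le_sum fun i _ => (h _ (1 / ((n : ℝ) + 1)) (by positivity)).trans
        (ENNReal.ofReal_le_ofReal (mul_le_mul_of_nonneg_right (le_abs_self C)
          (by positivity)))).trans ?_
      rw [Finset.sum_const, Finset.card_range, nsmul_eq_mul]
      have h7 : ((n + 1 : ℕ) : ℝ≥0∞) = ENNReal.ofReal ((n : ℝ) + 1) := by
        rw [← Nat.cast_succ, ENNReal.ofReal_natCast]
      rw [h7, ← ENNReal.ofReal_mul hn.le]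
      refine ENNReal.ofReal_le_ofReal (le_of_eq ?_)
      rw [one_div, Real.inv_rpow hn.le, ← Real.rpow_neg hn.le, sub_eq_add_neg,
        Real.rpow_add hn, Real.rpow_one]
      ring
    have hlim : Tendsto (fun n : ℕ => ENNReal.ofReal (|C| * ((n : ℝ) + 1) ^ (1 - α))) atTop (𝓝 0) := by
      have h1 : Tendsto (fun x : ℝ => x ^ (1 - α)) atTop (𝓝 0) := by
        have := tendsto_rpow_neg_atTop (show 0 < α - 1 by linarith)
        simpa using this
      have h2 := (h1.comp (tendsto_atTop_add_const_right atTop (1 : ℝ)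
        tendsto_natCast_atTop_atTop)).const_mul |C|
      rw [mul_zero] at h2
      simpa using ENNReal.tendsto_ofReal h2
    exact le_antisymm (ge_of_tendsto' hlim hbound) zero_le
  have h1 : (Set.univ : Set ℝ) ⊆ ⋃ m : ℤ, Set.Icc (m : ℝ) (m + 1) := fun t _ =>
    Set.mem_iUnion.2 ⟨⌊t⌋, Int.floor_le t, (Int.lt_floor_add_one t).le⟩
  have h2 := measure_mono_null h1 (measure_iUnion_null hcell)
  rw [measure_univ] at h2
  exact one_ne_zero h2

end Distribution

/-! ### Polynomials compared with a size built from their roots -/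

section RationalFunctions

open Polynomial

/-- A size of a polynomial adapted to evaluation at points of order one. -/
noncomputable def rootSize (p : ℂ[X]) : ℝ :=
  ‖p.leadingCoeff‖ * (p.roots.map fun a => 1 + ‖a‖).prod

lemma norm_eval_eq (p : ℂ[X]) (t : ℂ) :
    ‖p.eval t‖ = ‖p.leadingCoeff‖ * (p.roots.map fun a => ‖t - a‖).prod := by
  rw [(IsAlgClosed.splits p).eval_eq_prod_roots, norm_mul]
  congr 1
  have := map_multiset_prod (normHom (α := ℂ)) (p.roots.map fun a => t - a)
  simpa [Multiset.map_map] using this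

lemma rootSize_pos {p : ℂ[X]} (hp : p ≠ 0) : 0 < rootSize p := by
  refine mul_pos (norm_pos_iff.2 (leadingCoeff_ne_zero.2 hp)) (Multiset.prod_pos ?_)
  intro x hx
  obtain ⟨a, _, rfl⟩ := Multiset.mem_map.1 hx
  positivity

/-- Factor by factor, |t - a| ≤ (1 + |t|)(1 + |a|). -/
lemma norm_eval_le_rootSize (p : ℂ[X]) (t : ℝ) :
    ‖p.eval (t : ℂ)‖ ≤ rootSize p * (1 + |t|) ^ p.natDegree := by
  rw [norm_eval_eq, rootSize, mul_assoc]
  gcongr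
  rw [← (splits_iff_card_roots.1 (IsAlgClosed.splits p)), ← Multiset.card_map (fun a => 1 + ‖a‖),
    ← Multiset.prod_replicate, ← Multiset.map_const', Multiset.map_map, ← Multiset.prod_map_mul]
  refine Multiset.prod_map_le_prod_map₀ _ _ (fun a _ => norm_nonneg _) fun a _ => ?_
  have : ‖(t : ℂ) - a‖ ≤ |t| + ‖a‖ := by
    refine (norm_sub_le _ _).trans ?_
    rw [Complex.norm_real, Real.norm_eq_abs]
  simp only [Function.comp]
  nlinarith [norm_nonneg a, abs_nonneg t]

/-- The converse comparison, factor by factor: 1 + |a| ≤ (1 + |t|)(1 + |t - a|), where 1 + |t - a| =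
|t - a|(1 + 1/|t - a|). The loss comes from large t and from t near a root. -/
lemma rootSize_le_mul_norm_eval {p : ℂ[X]} {t : ℝ} (hp : p.eval (t : ℂ) ≠ 0) :
    rootSize p ≤ ‖p.eval (t : ℂ)‖ * ((1 + |t|) ^ p.natDegree *
      (p.roots.map fun a => 1 + 1 / ‖(t : ℂ) - a‖).prod) := by
  have hp0 : p ≠ 0 := fun h => hp (by simp [h])
  rw [norm_eval_eq, rootSize, mul_assoc]
  gcongr
  have h1 : (1 + |t|) ^ p.natDegree = (p.roots.map fun _ => 1 + |t|).prod := by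
    rw [Multiset.map_const', Multiset.prod_replicate,
      splits_iff_card_roots.1 (IsAlgClosed.splits p)]
  rw [h1, ← Multiset.prod_map_mul, ← Multiset.prod_map_mul]
  refine Multiset.prod_map_le_prod_map₀ _ _ (fun a _ => by positivity) fun a ha => ?_
  have hne : 0 < ‖(t : ℂ) - a‖ := by
    rw [norm_pos_iff, sub_ne_zero]
    rintro rfl
    exact hp ((mem_roots hp0).1 ha)
  have h2 : ‖a‖ ≤ |t| + ‖(t : ℂ) - a‖ := by
    have := norm_sub_le (t : ℂ) ((t : ℂ) - a)
    rwa [sub_sub_cancel, Complex.norm_real, Real.norm_eq_abs] at this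
  have h3 : ‖(t : ℂ) - a‖ * ((1 + |t|) * (1 + 1 / ‖(t : ℂ) - a‖)) =
      (1 + |t|) * (‖(t : ℂ) - a‖ + 1) := by
    field_simp
  rw [h3]
  nlinarith [abs_nonneg t, mul_nonneg (abs_nonneg t) hne.le]

end RationalFunctions

/-! ### Moments of rational functions do not concentrate on small sets -/

section Decoupling

open Polynomial

lemma le_add_rpow_div {X L P : ℝ} (hX : 0 ≤ X) (hL : 0 < L) (hP : 1 < P) :
    X ≤ L + X ^ P / L ^ (P - 1) := by
  rcases le_or_gt X L with h | h
  · have : 0 ≤ X ^ P / L ^ (P - 1) := by positivity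
    linarith
  · have hX' : 0 < X := hL.trans h
    have h1 : X ≤ X ^ P / L ^ (P - 1) := by
      rw [le_div_iff₀ (by positivity)]
      calc X * L ^ (P - 1) ≤ X * X ^ (P - 1) := by
            gcongr
        _ = X ^ P := by
            nth_rewrite 1 [← Real.rpow_one X]
            rw [← Real.rpow_add hX']
            congr 1; ring
    linarith

/-- In place of Hölder's inequality: the right side X is at least 1, bounds 1 + r by X^{1/q} and
each root factor by X^{1/β}, and the total exponent is at most 1. Repeated roots need only one
summand. -/
lemma pow_mul_prod_rpow_le {d : ℕ} {s q β r : ℝ} (hs : 0 < s) (hq : 0 < q) (hβ : 0 < β)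
    (hr : 0 ≤ r) (M : Multiset ℂ) (t : ℂ)
    (h : s * (d / q + Multiset.card M / β) ≤ 1) :
    ((1 + r) ^ d * (M.map fun a => 1 + 1 / ‖t - a‖).prod) ^ s ≤
      (1 + r) ^ q + ∑ a ∈ M.toFinset, (1 + 1 / ‖t - a‖) ^ β := by
  set X := (1 + r) ^ q + ∑ a ∈ M.toFinset, (1 + 1 / ‖t - a‖) ^ β with hX
  have hXsum : 0 ≤ ∑ a ∈ M.toFinset, (1 + 1 / ‖t - a‖) ^ β :=
    Finset.sum_nonneg fun a _ => by positivity
  have h1q : 1 ≤ (1 + r) ^ q := Real.one_le_rpow (by linarith) hq.le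
  have hX1 : 1 ≤ X := by linarith
  have hX0 : 0 < X := by linarith
  have h1 : 1 + r ≤ X ^ (1 / q) := by
    calc 1 + r = ((1 + r) ^ q) ^ (1 / q) := by
          rw [← Real.rpow_mul (by linarith), mul_one_div_cancel hq.ne', Real.rpow_one]
      _ ≤ X ^ (1 / q) := by
          gcongr
          linarith
  have h2 : (M.map fun a => 1 + 1 / ‖t - a‖).prod ≤ (X ^ (1 / β)) ^ Multiset.card M := by
    rw [← Multiset.prod_replicate, ← Multiset.map_const']
    refine Multiset.prod_map_le_prod_map₀ _ _ (fun a _ => by positivity) fun a ha => ?_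
    calc 1 + 1 / ‖t - a‖ = ((1 + 1 / ‖t - a‖) ^ β) ^ (1 / β) := by
          rw [← Real.rpow_mul (by positivity), mul_one_div_cancel hβ.ne', Real.rpow_one]
      _ ≤ X ^ (1 / β) := by
          gcongr
          have := Finset.single_le_sum (f := fun a => (1 + 1 / ‖t - a‖) ^ β)
            (fun a _ => by positivity) (Multiset.mem_toFinset.2 ha)
          linarith
  have h3 : 0 ≤ (M.map fun a => 1 + 1 / ‖t - a‖).prod := Multiset.prod_nonneg fun x hx => by
    obtain ⟨a, _, rfl⟩ := Multiset.mem_map.1 hx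
    positivity
  calc ((1 + r) ^ d * (M.map fun a => 1 + 1 / ‖t - a‖).prod) ^ s
      ≤ ((X ^ (1 / q)) ^ d * (X ^ (1 / β)) ^ Multiset.card M) ^ s := by gcongr
    _ = X ^ (s * (d / q + Multiset.card M / β)) := by
        rw [← Real.rpow_natCast, ← Real.rpow_natCast, ← Real.rpow_mul hX0.le, ← Real.rpow_mul hX0.le,
          ← Real.rpow_add hX0, ← Real.rpow_mul hX0.le]
        congr 1; ring
    _ ≤ X ^ (1 : ℝ) := Real.rpow_le_rpow_of_exponent_le hX1 h
    _ = X := Real.rpow_one X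

lemma exists_exponents {x y s q α : ℝ} (hx : 0 ≤ x) (hy : 0 ≤ y) (hs : 0 < s) (hq : 0 < q)
    (hα : 0 < α) (h : s * (x / q + y / α) < 1) :
    ∃ P β : ℝ, 1 < P ∧ 0 < β ∧ β < α ∧ s * P * (x / q + y / β) ≤ 1 := by
  set τ := s * (x / q + y / α) with hτ
  have hτ0 : 0 ≤ τ := by positivity
  have h2 : 1 < 2 / (1 + τ) := by rw [lt_div_iff₀ (by linarith)]; linarith
  -- The slack τ < 1 is shared equally: P = ρ and β = α/ρ cost a factor of at most ρ² = 2/(1 + τ),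
  -- and 2τ/(1 + τ) ≤ 1.
  set ρ := Real.sqrt (2 / (1 + τ)) with hρ
  have hρ1 : 1 < ρ := by
    rw [hρ]; exact Real.lt_sqrt_of_sq_lt (by linarith)
  have hρ2 : ρ * ρ = 2 / (1 + τ) := Real.mul_self_sqrt (by linarith)
  refine ⟨ρ, α / ρ, hρ1, by positivity, div_lt_self hα hρ1, ?_⟩
  have hxq : 0 ≤ x / q := by positivity
  calc s * ρ * (x / q + y / (α / ρ)) = s * ρ * (x / q + ρ * (y / α)) := by
        congr 2; field_simp
    _ ≤ s * ρ * (ρ * (x / q) + ρ * (y / α)) := by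
        gcongr
        nlinarith
    _ = (ρ * ρ) * τ := by rw [hτ]; ring
    _ ≤ 1 := by
        rw [hρ2, div_mul_eq_mul_div, div_le_one (by linarith)]
        linarith

lemma measure_biUnion_ball_le {μ : Measure ℝ} {δ η : ℝ}
    (hδ : ∀ b : ℂ, μ {t : ℝ | ‖(t : ℂ) - b‖ ≤ δ} ≤ ENNReal.ofReal η) (F : Finset ℂ) {n : ℕ}
    (hF : F.card ≤ n) :
    μ (⋃ a ∈ F, {t : ℝ | ‖(t : ℂ) - a‖ ≤ δ}) ≤ n * ENNReal.ofReal η := by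
  refine (measure_biUnion_finset_le _ _).trans ((Finset.sum_le_sum fun a _ => hδ a).trans ?_)
  rw [Finset.sum_const, nsmul_eq_mul]
  gcongr

lemma measurableSet_ball_real (δ : ℝ) (a : ℂ) : MeasurableSet {t : ℝ | ‖(t : ℂ) - a‖ ≤ δ} :=
  measurableSet_le (by fun_prop) measurable_const

lemma card_roots_toFinset_le {p : ℂ[X]} {d : ℕ} (h : p.natDegree ≤ d) :
    p.roots.toFinset.card ≤ d :=
  (Multiset.toFinset_card_le _).trans ((card_roots' p).trans h)

lemma rootSize_le_of_roots_far {p : ℂ[X]} (hp : p ≠ 0) {d : ℕ} (hd : p.natDegree ≤ d) {R δ t : ℝ}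
    (hδ : 0 < δ) (ht : |t| ≤ R) (h : ∀ a ∈ p.roots, δ < ‖(t : ℂ) - a‖) :
    p.eval (t : ℂ) ≠ 0 ∧
      rootSize p ≤ ‖p.eval (t : ℂ)‖ * ((1 + R) * (1 + 1 / δ)) ^ d := by
  have h0 : p.eval (t : ℂ) ≠ 0 := by
    intro h0
    have := h t ((mem_roots hp).2 h0)
    simp at this
    linarith
  have hR : 0 ≤ R := (abs_nonneg t).trans ht
  refine ⟨h0, (rootSize_le_mul_norm_eval h0).trans ?_⟩
  gcongr
  have h1 : (p.roots.map fun a => 1 + 1 / ‖(t : ℂ) - a‖).prod ≤ (1 + 1 / δ) ^ p.natDegree := by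
    rw [← splits_iff_card_roots.1 (IsAlgClosed.splits p), ← Multiset.prod_replicate,
      ← Multiset.map_const']
    refine Multiset.prod_map_le_prod_map₀ _ _ (fun a _ => by positivity) fun a ha => ?_
    have := (h a ha).le
    gcongr
  calc (1 + |t|) ^ p.natDegree * (p.roots.map fun a => 1 + 1 / ‖(t : ℂ) - a‖).prod
      ≤ (1 + R) ^ p.natDegree * (1 + 1 / δ) ^ p.natDegree := by
        refine mul_le_mul ?_ h1 (Multiset.prod_nonneg fun x hx => ?_) (by positivity)
        · gcongr
        · obtain ⟨a, _, rfl⟩ := Multiset.mem_map.1 hx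
          positivity
    _ = ((1 + R) * (1 + 1 / δ)) ^ p.natDegree := (mul_pow _ _ _).symm
    _ ≤ _ := by
        refine pow_le_pow_right₀ ?_ hd
        have : 0 < 1 / δ := by positivity
        nlinarith

lemma lintegral_one_add_rpow_add_sum_le {μ : Measure ℝ} {q β M₁ M₂ : ℝ} {m : ℕ} (hM₁ : 0 ≤ M₁)
    (hM₂ : 0 ≤ M₂) (h₁ : ∫⁻ t, ENNReal.ofReal ((1 + |t|) ^ q) ∂μ ≤ ENNReal.ofReal M₁)
    (h₂ : ∀ b : ℂ, ∫⁻ t : ℝ, ENNReal.ofReal ((1 + 1 / ‖(t : ℂ) - b‖) ^ β) ∂μ ≤ ENNReal.ofReal M₂)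
    (F : Finset ℂ) (hF : F.card ≤ m) :
    ∫⁻ t : ℝ, ENNReal.ofReal ((1 + |t|) ^ q + ∑ a ∈ F, (1 + 1 / ‖(t : ℂ) - a‖) ^ β) ∂μ ≤
      ENNReal.ofReal (M₁ + m * M₂) := by
  have h1 : ∀ t : ℝ, ENNReal.ofReal ((1 + |t|) ^ q + ∑ a ∈ F, (1 + 1 / ‖(t : ℂ) - a‖) ^ β) =
      ENNReal.ofReal ((1 + |t|) ^ q) +
        ∑ a ∈ F, ENNReal.ofReal ((1 + 1 / ‖(t : ℂ) - a‖) ^ β) := fun t => by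
    rw [ENNReal.ofReal_add (by positivity) (Finset.sum_nonneg fun a _ => by positivity),
      ENNReal.ofReal_sum_of_nonneg fun a _ => by positivity]
  rw [lintegral_congr h1, lintegral_add_left (by fun_prop),
    lintegral_finsetSum _ fun a _ => by fun_prop]
  calc _ ≤ ENNReal.ofReal M₁ + ∑ a ∈ F, ENNReal.ofReal M₂ :=
        add_le_add h₁ (Finset.sum_le_sum fun a _ => h₂ a)
    _ ≤ ENNReal.ofReal M₁ + m * ENNReal.ofReal M₂ := by
        rw [Finset.sum_const, nsmul_eq_mul]
        gcongr
    _ ≤ _ := by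
        rw [← ENNReal.ofReal_natCast, ← ENNReal.ofReal_mul (by positivity),
          ← ENNReal.ofReal_add hM₁ (by positivity)]

set_option maxHeartbeats 1000000 in
/-- A bounded-degree rational function cannot concentrate its `s`-th moment on a set of small
measure. -/
theorem exists_rational_decoupling {α q s C₁ C₂ : ℝ} (hα : 0 < α) (hq : 0 < q) (hs : 0 < s)
    (d m : ℕ) (h : s * (((d + m : ℕ) : ℝ) / q + m / α) < 1) :
    ∃ η : ℝ, 0 < η ∧ ∀ μ : Measure ℝ, IsProbabilityMeasure μ → IsAlphaRegular μ α C₁ →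
      HasMomentBound μ q C₂ → ∀ S : Set ℝ, MeasurableSet S → μ S ≤ ENNReal.ofReal η →
      ∀ p Q : ℂ[X], p.natDegree ≤ d → Q.natDegree ≤ m → Q ≠ 0 →
        ∫⁻ t in S, ENNReal.ofReal (‖p.eval (t : ℂ) / Q.eval (t : ℂ)‖ ^ s) ∂μ ≤
          ∫⁻ t in Sᶜ, ENNReal.ofReal (‖p.eval (t : ℂ) / Q.eval (t : ℂ)‖ ^ s) ∂μ := by
  obtain ⟨P, β, hP, hβ, hβα, hPβ⟩ := exists_exponents (Nat.cast_nonneg _) (Nat.cast_nonneg _)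
    hs hq hα h
  obtain ⟨M₁, hM₁, hmom⟩ := HasMomentBound.exists_lintegral_one_add_le (C := C₂) hq
  obtain ⟨M₂, hM₂, hinv⟩ := IsAlphaRegular.exists_lintegral_inv_le (C := C₁) hβ hβα
  obtain ⟨R, hR, htail⟩ := HasMomentBound.exists_tail_le (C := C₂) hq (show (0:ℝ) < 1 / 8 by norm_num)
  obtain ⟨δ, hδ, hball⟩ := IsAlphaRegular.exists_ball_le (C := C₁) hα
    (show (0:ℝ) < 1 / (8 * (d + m + 1)) by positivity)
  -- In units of N = `rootSize p / rootSize Q`, c₀ is a lower bound for |p/Q| at points of [-R, R]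
  -- farther than δ from every root of p and Q.
  set c₀ : ℝ := 1 / (((1 + R) * (1 + 1 / δ)) ^ d * (1 + R) ^ m) with hc₀
  have hc₀pos : 0 < c₀ := by positivity
  set M : ℝ := M₁ + m * M₂ + 1 with hM
  have hMpos : 0 < M := by positivity
  -- Truncation level: the part of the s-th power above L has integral at most N^s c₀^s/8 over the
  -- whole line, hence over any S.
  set L : ℝ := (8 * M / c₀ ^ s) ^ (1 / (P - 1)) with hL
  have hLpos : 0 < L := by positivity
  have hLP : L ^ (P - 1) = 8 * M / c₀ ^ s := by
    rw [hL, ← Real.rpow_mul (by positivity), one_div_mul_cancel (by linarith), Real.rpow_one]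
  -- The first bound leaves a good set of measure at least 1/2 outside S; the second makes the
  -- truncated part contribute at most N^s c₀^s/8 on S.
  refine ⟨min (1 / 4) (c₀ ^ s / (8 * L)), by positivity, ?_⟩
  intro μ hμ hreg hmb S hS hμS p Q hp hQ hQ0
  rcases eq_or_ne p 0 with rfl | hp0
  · simp [Real.zero_rpow hs.ne']
  set N : ℝ := rootSize p / rootSize Q with hN
  have hBp := rootSize_pos hp0
  have hBQ := rootSize_pos hQ0
  have hNpos : 0 < N := by positivity
  set Y : ℝ → ℝ := fun t => (1 + |t|) ^ q + ∑ a ∈ Q.roots.toFinset, (1 + 1 / ‖(t : ℂ) - a‖) ^ β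
    with hY
  have hY0 : ∀ t, 0 ≤ Y t := fun t =>
    add_nonneg (by positivity) (Finset.sum_nonneg fun a _ => by positivity)
  have hYint : ∫⁻ t, ENNReal.ofReal (Y t) ∂μ ≤ ENNReal.ofReal M := by
    refine (lintegral_one_add_rpow_add_sum_le hM₁ hM₂ (hmom μ hμ hmb) (hinv μ hμ hreg) _
      (card_roots_toFinset_le hQ)).trans (ENNReal.ofReal_le_ofReal (by linarith))
  have hupper : ∀ t : ℝ, ‖p.eval (t : ℂ) / Q.eval (t : ℂ)‖ ^ s ≤
      N ^ s * (L + c₀ ^ s / (8 * M) * Y t) := by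
    intro t
    -- At a zero of Q the quotient is 0 by convention.
    rcases eq_or_ne (Q.eval (t : ℂ)) 0 with h0 | h0
    · rw [h0, div_zero, norm_zero, Real.zero_rpow hs.ne']
      have := hY0 t
      positivity
    set U : ℝ := (1 + |t|) ^ (d + m) * (Q.roots.map fun a => 1 + 1 / ‖(t : ℂ) - a‖).prod with hU
    have hprod : 0 ≤ (Q.roots.map fun a => 1 + 1 / ‖(t : ℂ) - a‖).prod :=
      Multiset.prod_nonneg fun x hx => by
        obtain ⟨a, _, rfl⟩ := Multiset.mem_map.1 hx
        positivity
    have hU0 : 0 ≤ U := by positivity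
    have h1t : 1 ≤ 1 + |t| := by linarith [abs_nonneg t]
    have h1 : ‖p.eval (t : ℂ) / Q.eval (t : ℂ)‖ ≤ N * U := by
      rw [norm_div, div_le_iff₀ (norm_pos_iff.2 h0), hN, div_mul_eq_mul_div, div_mul_eq_mul_div,
        le_div_iff₀ hBQ]
      calc ‖p.eval (t : ℂ)‖ * rootSize Q
          ≤ (rootSize p * (1 + |t|) ^ d) * (‖Q.eval (t : ℂ)‖ * ((1 + |t|) ^ m *
              (Q.roots.map fun a => 1 + 1 / ‖(t : ℂ) - a‖).prod)) := by
            gcongr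
            · refine (norm_eval_le_rootSize p t).trans ?_
              gcongr
            · refine (rootSize_le_mul_norm_eval h0).trans ?_
              gcongr
        _ = _ := by rw [hU, pow_add]; ring
    have h2 : U ^ (s * P) ≤ Y t := by
      refine pow_mul_prod_rpow_le (by positivity) hq hβ (abs_nonneg t) Q.roots t ?_
      refine le_trans ?_ hPβ
      gcongr
      exact (card_roots' Q).trans hQ
    calc ‖p.eval (t : ℂ) / Q.eval (t : ℂ)‖ ^ s ≤ (N * U) ^ s := by gcongr
      _ = N ^ s * U ^ s := Real.mul_rpow hNpos.le hU0
      _ ≤ N ^ s * (L + (U ^ s) ^ P / L ^ (P - 1)) := by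
          gcongr
          exact le_add_rpow_div (by positivity) hLpos hP
      _ ≤ N ^ s * (L + Y t / L ^ (P - 1)) := by
          rw [← Real.rpow_mul hU0]
          gcongr
      _ = _ := by
          rw [hLP]
          congr 2
          field_simp
  set bad : Set ℝ := {t | R < |t|} ∪ ((⋃ a ∈ p.roots.toFinset, {t : ℝ | ‖(t : ℂ) - a‖ ≤ δ}) ∪
    (⋃ a ∈ Q.roots.toFinset, {t : ℝ | ‖(t : ℂ) - a‖ ≤ δ})) with hbad
  have hbadmeas : MeasurableSet bad := by
    refine (measurableSet_lt measurable_const (by fun_prop)).union (MeasurableSet.union ?_ ?_) <;>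
    exact Finset.measurableSet_biUnion _ fun a _ => measurableSet_ball_real δ a
  have hbadμ : μ bad ≤ ENNReal.ofReal (1 / 4) := by
    calc μ bad ≤ ENNReal.ofReal (1 / 8) + (d * ENNReal.ofReal (1 / (8 * (d + m + 1))) +
          m * ENNReal.ofReal (1 / (8 * (d + m + 1)))) :=
        (measure_union_le _ _).trans (add_le_add (htail μ hmb) ((measure_union_le _ _).trans
          (add_le_add (measure_biUnion_ball_le (hball μ hreg) _ (card_roots_toFinset_le hp))
            (measure_biUnion_ball_le (hball μ hreg) _ (card_roots_toFinset_le hQ)))))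
      _ ≤ _ := by
        rw [← ENNReal.ofReal_natCast, ← ENNReal.ofReal_natCast, ← ENNReal.ofReal_mul (by positivity),
          ← ENNReal.ofReal_mul (by positivity), ← ENNReal.ofReal_add (by positivity) (by positivity),
          ← ENNReal.ofReal_add (by positivity) (by positivity)]
        refine ENNReal.ofReal_le_ofReal ?_
        rw [← add_mul, mul_one_div]
        have : ((d : ℝ) + m) / (8 * (d + m + 1)) ≤ 1 / 8 := by
          rw [div_le_div_iff₀ (by positivity) (by norm_num)]
          linarith
        linarith
  have hlower : ∀ t : ℝ, t ∉ bad → N ^ s * c₀ ^ s ≤ ‖p.eval (t : ℂ) / Q.eval (t : ℂ)‖ ^ s := by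
    intro t ht
    simp only [hbad, Set.mem_union, Set.mem_iUnion, Multiset.mem_toFinset, Set.mem_ofPred_eq,
      not_or, not_exists, not_lt, not_le, exists_prop, not_and] at ht
    obtain ⟨ht1, ht2, ht3⟩ := ht
    have h1 := (rootSize_le_of_roots_far hp0 hp hδ ht1 ht2).2
    have h0 := (rootSize_le_of_roots_far hQ0 hQ hδ ht1 ht3).1
    have h2 : ‖Q.eval (t : ℂ)‖ ≤ rootSize Q * (1 + R) ^ m := by
      refine (norm_eval_le_rootSize Q t).trans ?_
      gcongr
      calc (1 + |t|) ^ Q.natDegree ≤ (1 + R) ^ Q.natDegree := by gcongr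
        _ ≤ (1 + R) ^ m := pow_le_pow_right₀ (by linarith) hQ
    rw [← Real.mul_rpow hNpos.le hc₀pos.le]
    gcongr
    rw [norm_div, le_div_iff₀ (norm_pos_iff.2 h0), hN, hc₀]
    calc rootSize p / rootSize Q * (1 / (((1 + R) * (1 + 1 / δ)) ^ d * (1 + R) ^ m)) *
          ‖Q.eval (t : ℂ)‖
        ≤ (‖p.eval (t : ℂ)‖ * ((1 + R) * (1 + 1 / δ)) ^ d) / rootSize Q *
          (1 / (((1 + R) * (1 + 1 / δ)) ^ d * (1 + R) ^ m)) * (rootSize Q * (1 + R) ^ m) := by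
          gcongr
      _ = ‖p.eval (t : ℂ)‖ := by
          field_simp
  have hgood : ENNReal.ofReal (1 / 2) ≤ μ (Sᶜ ∩ badᶜ) := by
    rw [← Set.compl_union, prob_compl_eq_one_sub (hS.union hbadmeas)]
    have h1 : μ (S ∪ bad) ≤ ENNReal.ofReal (1 / 2) := by
      refine (measure_union_le _ _).trans ((add_le_add (hμS.trans (ENNReal.ofReal_le_ofReal
        (min_le_left _ _))) hbadμ).trans ?_)
      rw [← ENNReal.ofReal_add (by norm_num) (by norm_num)]
      exact ENNReal.ofReal_le_ofReal (by norm_num)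
    calc ENNReal.ofReal (1 / 2) = 1 - ENNReal.ofReal (1 / 2) := by
          rw [← ENNReal.ofReal_one, ← ENNReal.ofReal_sub _ (by norm_num)]
          norm_num
      _ ≤ _ := tsub_le_tsub_left h1 1
  calc ∫⁻ t in S, ENNReal.ofReal (‖p.eval (t : ℂ) / Q.eval (t : ℂ)‖ ^ s) ∂μ
      ≤ ∫⁻ t in S, (ENNReal.ofReal (N ^ s * L) +
          ENNReal.ofReal (N ^ s * (c₀ ^ s / (8 * M))) * ENNReal.ofReal (Y t)) ∂μ := by
        refine lintegral_mono fun t => ?_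
        rw [← ENNReal.ofReal_mul (by positivity),
          ← ENNReal.ofReal_add (by positivity) (mul_nonneg (by positivity) (hY0 t))]
        exact ENNReal.ofReal_le_ofReal ((hupper t).trans (le_of_eq (by ring)))
    _ = ENNReal.ofReal (N ^ s * L) * μ S + ENNReal.ofReal (N ^ s * (c₀ ^ s / (8 * M))) *
          ∫⁻ t in S, ENNReal.ofReal (Y t) ∂μ := by
        rw [lintegral_add_left measurable_const, lintegral_const, Measure.restrict_apply_univ,
          lintegral_const_mul _ (by fun_prop)]
    _ ≤ ENNReal.ofReal (N ^ s * L) * ENNReal.ofReal (c₀ ^ s / (8 * L)) +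
          ENNReal.ofReal (N ^ s * (c₀ ^ s / (8 * M))) * ENNReal.ofReal M := by
        gcongr
        · exact hμS.trans (ENNReal.ofReal_le_ofReal (min_le_right _ _))
        · exact (setLIntegral_le_lintegral _ _).trans hYint
    _ ≤ ENNReal.ofReal (N ^ s * c₀ ^ s) * ENNReal.ofReal (1 / 2) := by
        rw [← ENNReal.ofReal_mul (by positivity), ← ENNReal.ofReal_mul (by positivity),
          ← ENNReal.ofReal_mul (by positivity),
          ← ENNReal.ofReal_add (by positivity) (by positivity)]
        refine ENNReal.ofReal_le_ofReal ?_
        have e1 : N ^ s * L * (c₀ ^ s / (8 * L)) = N ^ s * c₀ ^ s / 8 := by field_simp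
        have e2 : N ^ s * (c₀ ^ s / (8 * M)) * M = N ^ s * c₀ ^ s / 8 := by field_simp
        rw [e1, e2]
        have : 0 < N ^ s * c₀ ^ s := by positivity
        linarith
    _ ≤ ENNReal.ofReal (N ^ s * c₀ ^ s) * μ (Sᶜ ∩ badᶜ) := by gcongr
    _ = ∫⁻ t in Sᶜ ∩ badᶜ, ENNReal.ofReal (N ^ s * c₀ ^ s) ∂μ := by
        rw [lintegral_const, Measure.restrict_apply_univ]
    _ ≤ ∫⁻ t in Sᶜ ∩ badᶜ, ENNReal.ofReal (‖p.eval (t : ℂ) / Q.eval (t : ℂ)‖ ^ s) ∂μ :=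
        setLIntegral_mono' (hS.compl.inter hbadmeas.compl) fun t ht =>
          ENNReal.ofReal_le_ofReal (hlower t ht.2)
    _ ≤ _ := lintegral_mono_set Set.inter_subset_left

end Decoupling

/-! ### Operator norm, entries, adjugate and determinant -/

section MatrixNorm

variable {k : ℕ}

lemma norm_entry_le (M : Mat k) (i j : Fin k) : ‖M i j‖ ≤ ‖M‖ := by
  rw [← toEuclideanLin_single M i j]
  refine (PiLp.norm_apply_le _ i).trans ((norm_toEuclideanLin_le M _).trans ?_)
  simp

lemma norm_fib_le_sum (u : Fib k) : ‖u‖ ≤ ∑ i, ‖u i‖ := by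
  have h := (EuclideanSpace.basisFun (Fin k) ℂ).sum_repr u
  calc ‖u‖ = ‖∑ i, (EuclideanSpace.basisFun (Fin k) ℂ).repr u i •
        EuclideanSpace.basisFun (Fin k) ℂ i‖ := by rw [h]
    _ ≤ ∑ i, ‖u i‖ := by
        refine (norm_sum_le _ _).trans (le_of_eq (Finset.sum_congr rfl fun i _ => ?_))
        rw [norm_smul]
        simp

lemma norm_le_sum_entries (M : Mat k) : ‖M‖ ≤ ∑ i, ∑ j, ‖M i j‖ := by
  rw [Matrix.l2_opNorm_def]
  refine ContinuousLinearMap.opNorm_le_bound _ (by positivity) fun u => ?_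
  refine (norm_fib_le_sum _).trans ?_
  rw [Finset.sum_mul]
  refine Finset.sum_le_sum fun i _ => ?_
  have : (Matrix.toEuclideanLin M u) i = ∑ j, M i j * u j := by
    simp [Matrix.mulVec, dotProduct]
  change ‖(Matrix.toEuclideanLin M u) i‖ ≤ _
  rw [this, Finset.sum_mul]
  refine (norm_sum_le _ _).trans (Finset.sum_le_sum fun j _ => ?_)
  rw [norm_mul]
  gcongr
  exact PiLp.norm_apply_le u j

lemma norm_one_le : ‖(1 : Mat k)‖ ≤ 1 := by
  rw [Matrix.l2_opNorm_def]
  refine ContinuousLinearMap.opNorm_le_bound _ zero_le_one fun u => ?_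
  simp

lemma exists_adjugate_bound (k : ℕ) (ρ : ℝ) :
    ∃ D : ℝ, 0 < D ∧ ∀ M : Mat k, ‖M‖ ≤ ρ → ‖M.adjugate‖ ≤ D := by
  obtain ⟨D, hD⟩ := (isCompact_closedBall (0 : Mat k) ρ).exists_bound_of_continuousOn
    (f := fun M => M.adjugate) (Continuous.matrix_adjugate continuous_id).continuousOn
  refine ⟨max D 1, by positivity, fun M hM => (hD M (by simpa using hM)).trans (le_max_left _ _)⟩

lemma exists_det_bound (k : ℕ) (ρ : ℝ) :
    ∃ D : ℝ, 0 < D ∧ ∀ M : Mat k, ‖M‖ ≤ ρ → ‖M.det‖ ≤ D := by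
  obtain ⟨D, hD⟩ := (isCompact_closedBall (0 : Mat k) ρ).exists_bound_of_continuousOn
    (f := fun M => M.det) (Continuous.matrix_det continuous_id).continuousOn
  refine ⟨max D 1, by positivity, fun M hM => (hD M (by simpa using hM)).trans (le_max_left _ _)⟩

end MatrixNorm

/-! ### Single-site expansion and decoupling -/

section SingleSite

lemma ofReal_rpow_sum_le {ι : Type*} (F : Finset ι) (a : ι → ℝ) (ha : ∀ i, 0 ≤ a i) {s : ℝ}
    (hs : 0 < s) (hs1 : s ≤ 1) :
    ENNReal.ofReal ((∑ i ∈ F, a i) ^ s) ≤ ∑ i ∈ F, ENNReal.ofReal (a i ^ s) := by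
  classical
  induction F using Finset.induction_on with
  | empty => simp [Real.zero_rpow hs.ne']
  | insert i F hi ih =>
    rw [Finset.sum_insert hi, Finset.sum_insert hi]
    have h0 : 0 ≤ ∑ i ∈ F, a i := Finset.sum_nonneg fun i _ => ha i
    refine (ENNReal.ofReal_le_ofReal (Real.rpow_add_le_add_rpow (ha i) h0 hs.le hs1)).trans ?_
    rw [ENNReal.ofReal_add (Real.rpow_nonneg (ha i) _) (by positivity)]
    gcongr

/-- Off a set of small measure, `tA + B - z` expands vectors by a factor of order `1 + |Re z|`. -/
lemma exists_expanding {α q C₁ C₂ b₁ b₂ : ℝ} (hα : 0 < α) (hq : 0 < q) (k : ℕ) {η : ℝ}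
    (hη : 0 < η) :
    ∃ c : ℝ, 0 < c ∧ ∀ μ : Measure ℝ, IsAlphaRegular μ α C₁ → HasMomentBound μ q C₂ →
      ∀ A B : Mat k, IsUnit A → ‖A‖ ≤ b₁ → ‖A⁻¹‖ ≤ b₁ → ‖B‖ ≤ b₂ →
      ∀ lam ε : ℝ, 0 < ε → ε ≤ 1 → ∃ S : Set ℝ, MeasurableSet S ∧ μ S ≤ ENNReal.ofReal η ∧
        ∀ t ∉ S, ∀ X : Mat k, (1 + |lam|) * ‖X‖ ≤
          c * ‖((t : ℂ) • A + B - ((lam : ℂ) + ε * Complex.I) • (1 : Mat k)) * X‖ := by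
  obtain ⟨R, hR, htail⟩ := HasMomentBound.exists_tail_le (C := C₂) hq (half_pos hη)
  obtain ⟨δ, hδ, hball⟩ := IsAlphaRegular.exists_ball_le (C := C₁) hα
    (show 0 < η / (2 * (k + 1)) by positivity)
  -- Beyond ℓ the energy dominates: ‖tA + B‖ ≤ |λ|/2 whenever |t| ≤ R. Below ℓ all matrices stay in
  -- a fixed ball, and only a small determinant can obstruct the bound.
  set ℓ : ℝ := 2 * (R * |b₁| + |b₂|) + 1 with hℓ
  have hℓ0 : 0 < ℓ := by positivity
  obtain ⟨D, hD, hadj⟩ := exists_adjugate_bound k (R * |b₁| + |b₂| + (ℓ + 1))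
  obtain ⟨D', hD', hdet⟩ := exists_det_bound k b₁
  refine ⟨max 4 ((1 + ℓ) * (D * (D' / δ ^ k))), by positivity, ?_⟩
  intro μ hreg hmb A B hAu hA hA' hB lam ε hε hε1
  set z : ℂ := (lam : ℂ) + ε * Complex.I with hz
  have hzre : |lam| ≤ ‖z‖ := by
    have := Complex.abs_re_le_norm z
    simpa [hz] using this
  have hzle : ‖z‖ ≤ |lam| + 1 := by
    refine (norm_add_le _ _).trans ?_
    rw [norm_mul, Complex.norm_real, Complex.norm_real, Complex.norm_I, mul_one,
      Real.norm_eq_abs, Real.norm_eq_abs, abs_of_pos hε]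
    linarith
  have hVnorm : ∀ t : ℝ, |t| ≤ R → ‖(t : ℂ) • A + B‖ ≤ R * |b₁| + |b₂| := by
    intro t ht
    refine (norm_add_le _ _).trans (add_le_add ?_ (hB.trans (le_abs_self _)))
    rw [norm_smul, Complex.norm_real, Real.norm_eq_abs]
    gcongr
    exact hA.trans (le_abs_self _)
  have htailmeas : MeasurableSet {t : ℝ | R < |t|} :=
    measurableSet_lt measurable_const (by fun_prop)
  rcases le_or_gt ℓ |lam| with hl | hl
  · refine ⟨{t | R < |t|}, htailmeas,
      (htail μ hmb).trans (ENNReal.ofReal_le_ofReal (by linarith)), fun t ht X => ?_⟩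
    have ht' : |t| ≤ R := not_lt.1 ht
    set Y := ((t : ℂ) • A + B - z • (1 : Mat k)) * X with hY
    have h1 : z • X = ((t : ℂ) • A + B) * X - Y := by
      rw [hY, sub_mul, smul_mul_assoc, one_mul, sub_sub_cancel]
    have h2 : ‖z‖ * ‖X‖ ≤ (R * |b₁| + |b₂|) * ‖X‖ + ‖Y‖ := by
      rw [← norm_smul, h1]
      refine (norm_sub_le _ _).trans ?_
      gcongr
      exact (norm_mul_le _ _).trans (by gcongr; exact hVnorm t ht')
    have h3 : (1 + |lam|) * ‖X‖ ≤ 4 * ‖Y‖ := by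
      have h4 : R * |b₁| + |b₂| ≤ |lam| / 2 := by linarith
      have h5 : 1 ≤ |lam| := by
        have : 0 ≤ R * |b₁| + |b₂| := by positivity
        linarith
      nlinarith [norm_nonneg X, mul_le_mul_of_nonneg_right hzre (norm_nonneg X),
        mul_le_mul_of_nonneg_right h4 (norm_nonneg X),
        mul_le_mul_of_nonneg_right h5 (norm_nonneg X)]
    exact h3.trans (by gcongr; exact le_max_left _ _)
  -- Since tA + B - z = A(t - E), the determinant is det A times the characteristic polynomial of E
  -- at t. It is bounded below once t is at distance δ from the eigenvalues, and the adjugate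
  -- formula then recovers X.
  · set E : Mat k := A⁻¹ * (z • 1 - B) with hE
    set S : Set ℝ := {t | R < |t|} ∪
      ⋃ a ∈ E.charpoly.roots.toFinset, {t : ℝ | ‖(t : ℂ) - a‖ ≤ δ} with hS
    have hcard : E.charpoly.natDegree ≤ k := by
      rw [Matrix.charpoly_natDegree_eq_dim, Fintype.card_fin]
    refine ⟨S, htailmeas.union (Finset.measurableSet_biUnion _ fun a _ =>
      measurableSet_ball_real δ a), ?_, fun t ht X => ?_⟩
    · refine (measure_union_le _ _).trans ((add_le_add (htail μ hmb)
        (measure_biUnion_ball_le (hball μ hreg) _ (card_roots_toFinset_le hcard))).trans ?_)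
      rw [← ENNReal.ofReal_natCast, ← ENNReal.ofReal_mul (by positivity),
        ← ENNReal.ofReal_add (by positivity) (by positivity)]
      refine ENNReal.ofReal_le_ofReal ?_
      have : (k : ℝ) * (η / (2 * (k + 1))) ≤ η / 2 := by
        rw [mul_div_assoc', div_le_div_iff₀ (by positivity) (by norm_num)]
        nlinarith
      linarith
    · simp only [hS, Set.mem_union, Set.mem_iUnion, Multiset.mem_toFinset, Set.mem_ofPred_eq,
        not_or, not_exists, not_lt, not_le, exists_prop, not_and] at ht
      obtain ⟨ht1, ht2⟩ := ht
      set M : Mat k := (t : ℂ) • A + B - z • (1 : Mat k) with hM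
      have hAdet : IsUnit A.det := (Matrix.isUnit_iff_isUnit_det A).1 hAu
      have hfac : M = A * (Matrix.scalar (Fin k) (t : ℂ) - E) := by
        have h1 : A * Matrix.scalar (Fin k) (t : ℂ) = (t : ℂ) • A := by
          rw [Matrix.scalar_apply, ← Matrix.smul_one_eq_diagonal, mul_smul_comm, mul_one]
        rw [mul_sub, h1, hE, ← mul_assoc, Matrix.mul_nonsing_inv _ hAdet, one_mul, hM]
        abel
      have hdetlow : δ ^ k / D' ≤ ‖M.det‖ := by
        have h1 : ‖A.det‖ * ‖A⁻¹.det‖ = 1 := by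
          rw [← norm_mul, ← Matrix.det_mul, Matrix.mul_nonsing_inv _ hAdet, Matrix.det_one,
            norm_one]
        have h2 : δ ^ k ≤ ‖(Matrix.scalar (Fin k) (t : ℂ) - E).det‖ := by
          rw [← Matrix.eval_charpoly, norm_eval_eq, (Matrix.charpoly_monic E).leadingCoeff,
            norm_one, one_mul]
          have h3 : δ ^ k = (E.charpoly.roots.map fun _ => δ).prod := by
            rw [Multiset.map_const', Multiset.prod_replicate,
              Polynomial.splits_iff_card_roots.1 (IsAlgClosed.splits _),
              Matrix.charpoly_natDegree_eq_dim, Fintype.card_fin]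
          rw [h3]
          exact Multiset.prod_map_le_prod_map₀ _ _ (fun a _ => hδ.le) fun a ha => (ht2 a ha).le
        have h3 := hdet _ hA'
        rw [hfac, Matrix.det_mul, norm_mul, div_le_iff₀ hD']
        calc δ ^ k = ‖A.det‖ * ‖A⁻¹.det‖ * δ ^ k := by rw [h1, one_mul]
          _ ≤ ‖A.det‖ * D' * ‖(Matrix.scalar (Fin k) (t : ℂ) - E).det‖ := by gcongr
          _ = _ := by ring
      have hpos : 0 < δ ^ k / D' := by positivity
      have hadjM : ‖M.adjugate‖ ≤ D := by
        refine hadj M ((norm_sub_le _ _).trans (add_le_add (hVnorm t ht1) ?_))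
        rw [norm_smul]
        calc ‖z‖ * ‖(1 : Mat k)‖ ≤ (|lam| + 1) * 1 := by gcongr; exact norm_one_le
          _ ≤ _ := by linarith
      have h4 : M.det • X = M.adjugate * (M * X) := by
        rw [← mul_assoc, Matrix.adjugate_mul, smul_mul_assoc, one_mul]
      have h5 : δ ^ k / D' * ‖X‖ ≤ D * ‖M * X‖ := by
        calc δ ^ k / D' * ‖X‖ ≤ ‖M.det‖ * ‖X‖ := by gcongr
          _ = ‖M.adjugate * (M * X)‖ := by rw [← norm_smul, h4]
          _ ≤ ‖M.adjugate‖ * ‖M * X‖ := norm_mul_le _ _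
          _ ≤ D * ‖M * X‖ := by gcongr
      have h6 : ‖X‖ ≤ D * (D' / δ ^ k) * ‖M * X‖ := by
        calc ‖X‖ = (D' / δ ^ k) * (δ ^ k / D' * ‖X‖) := by field_simp
          _ ≤ (D' / δ ^ k) * (D * ‖M * X‖) := by gcongr
          _ = _ := by ring
      calc (1 + |lam|) * ‖X‖ ≤ (1 + ℓ) * (D * (D' / δ ^ k) * ‖M * X‖) := by gcongr
        _ = (1 + ℓ) * (D * (D' / δ ^ k)) * ‖M * X‖ := by ring
        _ ≤ _ := by gcongr; exact le_max_right _ _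

/-- Single-site decoupling for solutions of a linear pencil. -/
theorem exists_pencil_decoupling {α q s C₁ C₂ b₁ b₂ : ℝ} (hα : 0 < α) (hq : 0 < q) (hs : 0 < s)
    (hs1 : s ≤ 1) (n : ℕ) (h : s * (((n + (n + 1) : ℕ) : ℝ) / q + ((n + 1 : ℕ) : ℝ) / α) < 1) :
    ∃ c : ℝ, 0 < c ∧ ∀ μ : Measure ℝ, IsProbabilityMeasure μ → IsAlphaRegular μ α C₁ →
      HasMomentBound μ q C₂ → ∀ A B : Mat (n + 1), IsUnit A → ‖A‖ ≤ b₁ → ‖A⁻¹‖ ≤ b₁ → ‖B‖ ≤ b₂ →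
      ∀ lam ε : ℝ, 0 < ε → ε ≤ 1 → ∀ (N F : Mat (n + 1)) (X : ℝ → Mat (n + 1)),
        (∀ t : ℝ, (1 + (t : ℂ) • N).det ≠ 0) → (∀ t : ℝ, (1 + (t : ℂ) • N) * X t = F) →
        ENNReal.ofReal ((1 + |lam|) ^ s) * ∫⁻ t, ENNReal.ofReal (‖X t‖ ^ s) ∂μ ≤
          ENNReal.ofReal c * ∫⁻ t : ℝ, ENNReal.ofReal (‖((t : ℂ) • A + B -
            ((lam : ℂ) + ε * Complex.I) • (1 : Mat (n + 1))) * X t‖ ^ s) ∂μ := by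
  obtain ⟨η, hη, hdec⟩ := exists_rational_decoupling (C₁ := C₁) (C₂ := C₂) hα hq hs n (n + 1) h
  obtain ⟨c, hc, hexp⟩ := exists_expanding (C₁ := C₁) (C₂ := C₂) (b₁ := b₁) (b₂ := b₂) hα hq
    (n + 1) hη
  refine ⟨((n + 1) * (n + 1) * 2) * c ^ s, by positivity, ?_⟩
  intro μ hμ hreg hmb A B hAu hA hA' hB lam ε hε hε1 N F X hdet hX
  obtain ⟨S, hS, hμS, hSX⟩ := hexp μ hreg hmb A B hAu hA hA' hB lam ε hε hε1
  obtain ⟨p, Q, hp, hQ, hQe, hpQ⟩ := exists_polynomial_of_linear_pencil N F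
  have hent : ∀ t : ℝ, ∀ i j, X t i j = (p i j).eval (t : ℂ) / Q.eval (t : ℂ) := fun t =>
    hpQ t (X t) (hdet t) (hX t)
  have hQ0 : Q ≠ 0 := by
    rintro rfl
    have := hQe 0
    simp at this
  have hmeas : ∀ i j, Measurable fun t : ℝ => ENNReal.ofReal (‖X t i j‖ ^ s) := by
    intro i j
    simp only [hent]
    have h1 : ∀ r : Polynomial ℂ, Measurable fun t : ℝ => r.eval (t : ℂ) := fun r =>
      (r.continuous.comp Complex.continuous_ofReal).measurable
    exact ((((h1 _).div (h1 _)).norm).pow_const s).ennreal_ofReal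
  -- Each entry is rational in t, so decoupling moves its moment off the exceptional set S, where
  -- the expansion bound is available.
  set J := ∫⁻ t in Sᶜ, ENNReal.ofReal (‖X t‖ ^ s) ∂μ with hJ
  have hij : ∀ i j, ∫⁻ t, ENNReal.ofReal (‖X t i j‖ ^ s) ∂μ ≤ 2 * J := by
    intro i j
    have h1 : ∫⁻ t in S, ENNReal.ofReal (‖X t i j‖ ^ s) ∂μ ≤
        ∫⁻ t in Sᶜ, ENNReal.ofReal (‖X t i j‖ ^ s) ∂μ := by
      simp only [hent]
      exact hdec μ hμ hreg hmb S hS hμS (p i j) Q (hp i j) hQ hQ0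
    have h2 : ∫⁻ t in Sᶜ, ENNReal.ofReal (‖X t i j‖ ^ s) ∂μ ≤ J :=
      lintegral_mono fun t => ENNReal.ofReal_le_ofReal
        (Real.rpow_le_rpow (norm_nonneg _) (norm_entry_le _ i j) hs.le)
    rw [← lintegral_add_compl _ hS, two_mul]
    exact add_le_add (h1.trans h2) h2
  have h1 : ∫⁻ t, ENNReal.ofReal (‖X t‖ ^ s) ∂μ ≤
      ENNReal.ofReal ((n + 1) * (n + 1) * 2) * J := by
    calc ∫⁻ t, ENNReal.ofReal (‖X t‖ ^ s) ∂μ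
        ≤ ∫⁻ t, ∑ i, ∑ j, ENNReal.ofReal (‖X t i j‖ ^ s) ∂μ := by
          refine lintegral_mono fun t => ?_
          refine (ENNReal.ofReal_le_ofReal (Real.rpow_le_rpow (norm_nonneg _)
            (norm_le_sum_entries (X t)) hs.le)).trans ?_
          refine (ofReal_rpow_sum_le _ _ (fun i => by positivity) hs hs1).trans ?_
          exact Finset.sum_le_sum fun i _ =>
            ofReal_rpow_sum_le _ _ (fun j => norm_nonneg _) hs hs1
      _ = ∑ i, ∑ j, ∫⁻ t, ENNReal.ofReal (‖X t i j‖ ^ s) ∂μ := by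
          rw [lintegral_finsetSum _ fun i _ => Finset.measurable_sum _ fun j _ => hmeas i j]
          refine Finset.sum_congr rfl fun i _ => ?_
          rw [lintegral_finsetSum _ fun j _ => hmeas i j]
      _ ≤ ∑ i : Fin (n + 1), ∑ j : Fin (n + 1), 2 * J :=
          Finset.sum_le_sum fun i _ => Finset.sum_le_sum fun j _ => hij i j
      _ = _ := by
          simp only [Finset.sum_const, Finset.card_univ, Fintype.card_fin, nsmul_eq_mul]
          rw [ENNReal.ofReal_mul (by positivity), ENNReal.ofReal_mul (by positivity)]
          have : ENNReal.ofReal ((n : ℝ) + 1) = ((n + 1 : ℕ) : ℝ≥0∞) := by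
            rw [← Nat.cast_succ, ENNReal.ofReal_natCast]
          rw [this, ENNReal.ofReal_ofNat]
          ring
  have h2 : ENNReal.ofReal ((1 + |lam|) ^ s) * J ≤
      ENNReal.ofReal (c ^ s) * ∫⁻ t : ℝ, ENNReal.ofReal (‖((t : ℂ) • A + B -
            ((lam : ℂ) + ε * Complex.I) • (1 : Mat (n + 1))) * X t‖ ^ s) ∂μ := by
    rw [hJ, ← lintegral_const_mul' _ _ ENNReal.ofReal_ne_top,
      ← lintegral_const_mul' _ _ ENNReal.ofReal_ne_top]
    refine (setLIntegral_mono' hS.compl fun t ht => ?_).trans (setLIntegral_le_lintegral _ _)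
    rw [← ENNReal.ofReal_mul (by positivity), ← ENNReal.ofReal_mul (by positivity),
      ← Real.mul_rpow (by positivity) (by positivity),
      ← Real.mul_rpow (by positivity) (by positivity)]
    exact ENNReal.ofReal_le_ofReal (Real.rpow_le_rpow (by positivity) (hSX t ht (X t)) hs.le)
  calc _ ≤ ENNReal.ofReal ((1 + |lam|) ^ s) * (ENNReal.ofReal ((n + 1) * (n + 1) * 2) * J) := by
        gcongr
    _ = ENNReal.ofReal ((n + 1) * (n + 1) * 2) * (ENNReal.ofReal ((1 + |lam|) ^ s) * J) := by ring
    _ ≤ _ := by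
        have e : ENNReal.ofReal (((n + 1) * (n + 1) * 2) * c ^ s) =
            ENNReal.ofReal ((n + 1) * (n + 1) * 2) * ENNReal.ofReal (c ^ s) :=
          ENNReal.ofReal_mul (by positivity)
        rw [e]
        exact (mul_le_mul_right h2 _).trans_eq (mul_assoc _ _ _).symm

end SingleSite

/-! ### Contractive inequalities on the graph -/

section Iteration

lemma ENNReal.le_of_forall_le_add_mul_half_pow {x y C : ℝ≥0∞} (hC : C ≠ ⊤)
    (h : ∀ n : ℕ, x ≤ y + C * (1 / 2) ^ n) : x ≤ y := by
  have h1 : Tendsto (fun n : ℕ => y + C * (1 / 2 : ℝ≥0∞) ^ n) atTop (𝓝 (y + C * 0)) := by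
    refine Tendsto.const_add y (ENNReal.Tendsto.const_mul ?_ (Or.inr hC))
    exact ENNReal.tendsto_pow_atTop_nhds_zero_of_lt_one (by simp)
  rw [mul_zero, add_zero] at h1
  exact ge_of_tendsto' h1 h

variable {V : Type u} {G : SimpleGraph V} [G.LocallyFinite] {κ : ℕ} {m : V → ℝ≥0∞} {y : V}
  {a ρ B : ℝ≥0∞}

lemma sum_neighbor_le (hdeg : ∀ x, G.degree x ≤ κ) {b : ℝ≥0∞} (x : V)
    (h : ∀ u, G.Adj x u → m u ≤ b) : ρ * ∑ u ∈ G.neighborFinset x, m u ≤ κ * ρ * b := by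
  calc ρ * ∑ u ∈ G.neighborFinset x, m u ≤ ρ * ∑ u ∈ G.neighborFinset x, b := by
        gcongr with u hu
        exact h u ((SimpleGraph.mem_neighborFinset _ _ _).1 hu)
    _ ≤ ρ * (κ * b) := by
        rw [Finset.sum_const, nsmul_eq_mul, SimpleGraph.card_neighborFinset_eq_degree]
        gcongr
        exact hdeg x
    _ = κ * ρ * b := by ring

open Classical in
-- The level 2a reproduces itself, a + (1/2)2a = 2a, while the excess B is halved at each iteration.
lemma le_two_mul_of_subharmonic (hdeg : ∀ x, G.degree x ≤ κ) (hB : B ≠ ⊤) (hmB : ∀ x, m x ≤ B)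
    (hρ : κ * ρ ≤ 1 / 2)
    (hm : ∀ x, m x ≤ a * (if x = y then 1 else 0) + ρ * ∑ u ∈ G.neighborFinset x, m u) (x : V) :
    m x ≤ 2 * a := by
  refine ENNReal.le_of_forall_le_add_mul_half_pow hB fun n => ?_
  induction n generalizing x with
  | zero =>
    rw [pow_zero, mul_one]
    exact le_add_left (hmB x)
  | succ n ih =>
    refine (hm x).trans ?_
    calc a * (if x = y then 1 else 0) + ρ * ∑ u ∈ G.neighborFinset x, m u
        ≤ a * 1 + 1 / 2 * (2 * a + B * (1 / 2) ^ n) := by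
          refine add_le_add (by gcongr; split_ifs <;> simp)
            ((sum_neighbor_le hdeg x fun u _ => ih u).trans ?_)
          gcongr
      _ = a * 1 + ((1 / 2 * 2) * a + B * (1 / 2) ^ (n + 1)) := by ring
      _ = _ := by
          rw [ENNReal.div_mul_cancel (by simp) (by simp)]
          ring

open Classical in
-- Each application of the inequality away from y gains κρ and uses up one edge of the walks. A
-- lower bound on all walk lengths, in place of the distance, also covers unreachable x, for which
-- every n is allowed.
lemma le_of_walk_length (hdeg : ∀ x, G.degree x ≤ κ) (hB : B ≠ ⊤) (hmB : ∀ x, m x ≤ B)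
    (hρ : κ * ρ ≤ 1 / 2)
    (hm : ∀ x, m x ≤ a * (if x = y then 1 else 0) + ρ * ∑ u ∈ G.neighborFinset x, m u) (n : ℕ)
    (x : V) (hn : ∀ p : G.Walk x y, n ≤ p.length) : m x ≤ 2 * a * (κ * ρ) ^ n := by
  induction n generalizing x with
  | zero =>
    rw [pow_zero, mul_one]
    exact le_two_mul_of_subharmonic hdeg hB hmB hρ hm x
  | succ n ih =>
    have hxy : x ≠ y := by
      rintro rfl
      have := hn SimpleGraph.Walk.nil
      simp at this
    refine (hm x).trans ?_
    rw [if_neg hxy, mul_zero, zero_add]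
    refine (sum_neighbor_le hdeg x fun u hu => ih u fun p => ?_).trans (le_of_eq (by ring))
    have := hn (SimpleGraph.Walk.cons hu p)
    rw [SimpleGraph.Walk.length_cons] at this
    omega

open Classical in
/-- Decay of solutions of a contractive graph inequality. -/
lemma le_powDist_of_subharmonic (hdeg : ∀ x, G.degree x ≤ κ) (hB : B ≠ ⊤) (hmB : ∀ x, m x ≤ B)
    (ha : a ≠ ⊤) (hρ : κ * ρ ≤ 1 / 2)
    (hm : ∀ x, m x ≤ a * (if x = y then 1 else 0) + ρ * ∑ u ∈ G.neighborFinset x, m u) (x : V) :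
    m x ≤ 2 * a * (if G.Reachable x y then (κ * ρ) ^ G.dist x y else 0) := by
  split_ifs with h
  · exact le_of_walk_length hdeg hB hmB hρ hm _ x fun p => SimpleGraph.dist_le p
  · refine ENNReal.le_of_forall_le_add_mul_half_pow (C := 2 * a)
      (ENNReal.mul_ne_top (by simp) ha) fun n => ?_
    rw [mul_zero, zero_add]
    refine (le_of_walk_length hdeg hB hmB hρ hm n x fun p => absurd ⟨p⟩ h).trans ?_
    gcongr

/-- Double counting: each b(u) is seen from the neighbours of u, at most κ of them. -/
lemma tsum_sum_neighbor_le (hdeg : ∀ x, G.degree x ≤ κ) (b : V → ℝ≥0∞) :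
    ∑' x, ∑ u ∈ G.neighborFinset x, b u ≤ κ * ∑' x, b x := by
  classical
  have h1 : ∀ x, ∑ u ∈ G.neighborFinset x, b u = ∑' u, if G.Adj x u then b u else 0 := by
    intro x
    rw [tsum_eq_sum (s := G.neighborFinset x)]
    · refine Finset.sum_congr rfl fun u hu => ?_
      rw [SimpleGraph.mem_neighborFinset] at hu
      rw [if_pos hu]
    · intro u hu
      rw [SimpleGraph.mem_neighborFinset] at hu
      rw [if_neg hu]
  simp_rw [h1]
  rw [ENNReal.tsum_comm, ← ENNReal.tsum_mul_left]
  refine ENNReal.tsum_le_tsum fun u => ?_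
  have h2 : ∑' x, (if G.Adj x u then b u else 0) = ∑ x ∈ G.neighborFinset u, b u := by
    rw [tsum_eq_sum (s := G.neighborFinset u)]
    · refine Finset.sum_congr rfl fun x hx => ?_
      rw [SimpleGraph.mem_neighborFinset] at hx
      rw [if_pos hx.symm]
    · intro x hx
      rw [SimpleGraph.mem_neighborFinset] at hx
      rw [if_neg fun h => hx h.symm]
  rw [h2, Finset.sum_const, nsmul_eq_mul, SimpleGraph.card_neighborFinset_eq_degree]
  gcongr
  exact hdeg u

open Classical in
/-- Summability of solutions of a contractive graph inequality. -/
lemma tsum_le_of_subharmonic (hdeg : ∀ x, G.degree x ≤ κ) (hB : B ≠ ⊤) (hmB : ∀ x, m x ≤ B)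
    (hρ : κ * ρ ≤ 1 / 2)
    (hm : ∀ x, m x ≤ a * (if x = y then 1 else 0) + ρ * ∑ u ∈ G.neighborFinset x, m u) :
    ∑' x, m x ≤ 2 * a := by
  -- The iterates of the inequality started from 0 keep total mass at most 2a. The remaining error
  -- is uniform in x but not summable, so the limit in n is taken over finite sets of sites.
  have key : ∀ n : ℕ, ∃ b : V → ℝ≥0∞, ∑' x, b x ≤ 2 * a ∧ ∀ x, m x ≤ b x + B * (1 / 2) ^ n := by
    intro n
    induction n with
    | zero => exact ⟨0, by simp, fun x => by simpa using hmB x⟩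
    | succ n ih =>
      obtain ⟨b, hb, hmb⟩ := ih
      refine ⟨fun x => a * (if x = y then 1 else 0) + ρ * ∑ u ∈ G.neighborFinset x, b u, ?_, ?_⟩
      · rw [ENNReal.tsum_add, ENNReal.tsum_mul_left, ENNReal.tsum_mul_left, tsum_ite_eq, mul_one]
        calc a + ρ * ∑' x, ∑ u ∈ G.neighborFinset x, b u ≤ a + ρ * (κ * (2 * a)) := by
              gcongr
              exact (tsum_sum_neighbor_le hdeg b).trans (by gcongr)
          _ = a + κ * ρ * (2 * a) := by ring
          _ ≤ a + 1 / 2 * (2 * a) := by gcongr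
          _ = 2 * a := by
              rw [← mul_assoc, ENNReal.div_mul_cancel (by simp) (by simp)]
              ring
      · intro x
        refine (hm x).trans ?_
        rw [add_assoc]
        gcongr
        calc ρ * ∑ u ∈ G.neighborFinset x, m u
            ≤ ρ * ∑ u ∈ G.neighborFinset x, (b u + B * (1 / 2) ^ n) := by
              gcongr with u hu
              exact hmb u
          _ = ρ * ∑ u ∈ G.neighborFinset x, b u +
                ρ * ∑ u ∈ G.neighborFinset x, B * (1 / 2) ^ n := by
              rw [Finset.sum_add_distrib, mul_add]
          _ ≤ ρ * ∑ u ∈ G.neighborFinset x, b u + B * (1 / 2) ^ (n + 1) := by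
              refine add_le_add le_rfl ?_
              refine (sum_neighbor_le (m := fun _ => B * (1 / 2) ^ n) hdeg x
                fun u _ => le_rfl).trans ?_
              calc κ * ρ * (B * (1 / 2) ^ n) ≤ 1 / 2 * (B * (1 / 2) ^ n) := by gcongr
                _ = _ := by ring
  rw [ENNReal.tsum_eq_iSup_sum]
  refine iSup_le fun F => ?_
  refine ENNReal.le_of_forall_le_add_mul_half_pow (C := F.card * B)
    (ENNReal.mul_ne_top (by simp) hB) fun n => ?_
  obtain ⟨b, hb, hmb⟩ := key n
  calc ∑ x ∈ F, m x ≤ ∑ x ∈ F, (b x + B * (1 / 2) ^ n) := Finset.sum_le_sum fun x _ => hmb x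
    _ = ∑ x ∈ F, b x + F.card * B * (1 / 2) ^ n := by
        rw [Finset.sum_add_distrib, Finset.sum_const, nsmul_eq_mul, mul_assoc]
    _ ≤ _ := by
        gcongr
        exact (ENNReal.sum_le_tsum F).trans hb

end Iteration

/-! ### Resampling one coordinate of a product measure -/

section Resampling

open Classical in
-- Replacing one coordinate by an independent draw leaves the product law unchanged; it suffices to
-- check finite cylinders. This permits integrating over v(x) with the other potentials frozen.
lemma map_update_prod_infinitePi {V : Type u} (μ : Measure ℝ) [IsProbabilityMeasure μ] (x : V) :
    Measure.map (fun p : (V → ℝ) × ℝ => Function.update p.1 x p.2)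
      ((Measure.infinitePi fun _ : V => μ).prod μ) = Measure.infinitePi fun _ : V => μ := by
  have hmeas : Measurable fun p : (V → ℝ) × ℝ => Function.update p.1 x p.2 := by
    rw [measurable_pi_iff]
    intro y
    rcases eq_or_ne y x with rfl | h
    · simpa using measurable_snd
    · simp only [Function.update_of_ne h]
      fun_prop
  refine Measure.eq_infinitePi _ fun F t ht => ?_
  rw [Measure.map_apply hmeas (MeasurableSet.pi F.countable_toSet fun i _ => ht i)]
  by_cases hx : x ∈ F
  · have h1 : (fun p : (V → ℝ) × ℝ => Function.update p.1 x p.2) ⁻¹' ((F : Set V).pi t) =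
        (((F.erase x : Finset V) : Set V).pi t) ×ˢ t x := by
      ext ⟨f, r⟩
      simp only [Set.mem_preimage, Set.mem_pi, Finset.mem_coe, Set.mem_prod, Finset.mem_erase]
      constructor
      · intro h
        refine ⟨fun i hi => ?_, by simpa using h x hx⟩
        simpa [Function.update_of_ne hi.1] using h i hi.2
      · rintro ⟨h, hr⟩ i hi
        rcases eq_or_ne i x with rfl | hne
        · simpa using hr
        · simpa [Function.update_of_ne hne] using h i ⟨hne, hi⟩
    rw [h1, Measure.prod_prod, Measure.infinitePi_pi _ fun i _ => ht i,
      Finset.prod_erase_mul F (fun i => μ (t i)) hx]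
  · have h1 : (fun p : (V → ℝ) × ℝ => Function.update p.1 x p.2) ⁻¹' ((F : Set V).pi t) =
        ((F : Set V).pi t) ×ˢ Set.univ := by
      ext ⟨f, r⟩
      simp only [Set.mem_preimage, Set.mem_pi, Finset.mem_coe, Set.mem_prod, Set.mem_univ, and_true]
      refine forall₂_congr fun i hi => ?_
      rw [Function.update_of_ne (by rintro rfl; exact hx hi)]
    rw [h1, Measure.prod_prod, Measure.infinitePi_pi _ fun i _ => ht i, measure_univ, mul_one]

open Classical in
lemma lintegral_update_infinitePi {V : Type u} (μ : Measure ℝ) [IsProbabilityMeasure μ] (x : V)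
    {F : (V → ℝ) → ℝ≥0∞} (hF : Measurable F) :
    ∫⁻ f, ∫⁻ t, F (Function.update f x t) ∂μ ∂(Measure.infinitePi fun _ : V => μ) =
      ∫⁻ f, F f ∂(Measure.infinitePi fun _ : V => μ) := by
  have hmeas : Measurable fun p : (V → ℝ) × ℝ => Function.update p.1 x p.2 := by
    rw [measurable_pi_iff]
    intro y
    rcases eq_or_ne y x with rfl | h
    · simpa using measurable_snd
    · simp only [Function.update_of_ne h]
      fun_prop
  conv_rhs => rw [← map_update_prod_infinitePi μ x]
  rw [lintegral_map hF hmeas]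
  exact (lintegral_prod _ (hF.comp hmeas).aemeasurable).symm

end Resampling

/-! ### Measurability and a priori bounds for the random Green function -/

section RandomGreen

variable {V : Type u} {k : ℕ} {G : SimpleGraph V} [G.LocallyFinite] {K : V → V → Mat k}
  {κ : ℕ} {c g : ℝ} {A B : V → Mat k} {z : ℂ}

lemma sitePotential_isHermitian (hA : ∀ x, (A x).IsHermitian) (hB : ∀ x, (B x).IsHermitian)
    (f : V → ℝ) (x : V) : (sitePotential A B f x).IsHermitian := by
  refine Matrix.IsHermitian.add ?_ (hB x)
  rw [Matrix.IsHermitian, Matrix.conjTranspose_smul, (hA x).eq]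
  simp

lemma continuous_sitePotential (x : V) : Continuous fun f : V → ℝ => sitePotential A B f x := by
  have h1 : Continuous fun f : V → ℝ => ((f x : ℝ) : ℂ) :=
    Complex.continuous_ofReal.comp (continuous_apply x)
  have h2 : Continuous fun f : V → ℝ => ((f x : ℝ) : ℂ) • A x := h1.smul continuous_const
  exact h2.add continuous_const

lemma IsBoundedHopping.continuous_green (hK : IsBoundedHopping G K κ c)
    (hA : ∀ x, (A x).IsHermitian) (hB : ∀ x, (B x).IsHermitian) (hz : z.im ≠ 0) (x y : V) :
    Continuous fun f : V → ℝ => green G K g (sitePotential A B f) z x y := by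
  classical
  refine continuous_matrix fun i j => ?_
  have h1 := hK.continuous_resolventOp (g := g) (sitePotential_isHermitian hA hB)
    continuous_sitePotential hz (lp.single 2 y (EuclideanSpace.single j (1 : ℂ)))
  have h2 : Continuous fun ψ : L2 V k => ψ x i :=
    (EuclideanSpace.proj i : Fib k →L[ℂ] ℂ).continuous.comp
      (lp.evalCLM ℂ (fun _ : V => Fib k) 2 x).continuous
  exact h2.comp h1

lemma IsBoundedHopping.measurable_green_rpow [Countable V] (hK : IsBoundedHopping G K κ c)
    (hA : ∀ x, (A x).IsHermitian) (hB : ∀ x, (B x).IsHermitian) (hz : z.im ≠ 0) (x y : V) (s : ℝ) :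
    Measurable fun f : V → ℝ =>
      ENNReal.ofReal (‖green G K g (sitePotential A B f) z x y‖ ^ s) :=
  (((hK.continuous_green hA hB hz x y).norm.measurable).pow_const s).ennreal_ofReal

open Classical in
lemma norm_apply_single_le (T : L2 V k →L[ℂ] L2 V k) (x y : V) (j : Fin k) :
    ‖T (lp.single 2 y (EuclideanSpace.single j (1 : ℂ))) x‖ ≤ ‖kernelAt T x y‖ := by
  rw [← kernelAt_apply]
  refine (norm_toEuclideanLin_le _ _).trans ?_
  simp

open Classical in
lemma norm_kernelAt_entry_le (T : L2 V k →L[ℂ] L2 V k) (x y : V) (i j : Fin k) :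
    ‖kernelAt T x y i j‖ ≤ ‖T (lp.single 2 y (EuclideanSpace.single j (1 : ℂ)))‖ :=
  (PiLp.norm_apply_le _ i).trans (lp.norm_apply_le_norm (by norm_num) _ x)

lemma IsBoundedHopping.norm_green_le (hK : IsBoundedHopping G K κ c) {W : V → Mat k}
    (hW : ∀ x, (W x).IsHermitian) (hz : z.im ≠ 0) (x y : V) :
    ‖green G K g W z x y‖ ≤ (k * k : ℝ) * |z.im|⁻¹ := by
  classical
  refine (norm_le_sum_entries _).trans ?_
  calc ∑ i, ∑ j, ‖green G K g W z x y i j‖ ≤ ∑ i : Fin k, ∑ j : Fin k, |z.im|⁻¹ := by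
        refine Finset.sum_le_sum fun i _ => Finset.sum_le_sum fun j _ => ?_
        refine (norm_kernelAt_entry_le _ x y i j).trans ?_
        rw [← one_mul |z.im|⁻¹, ← div_eq_mul_inv, le_div_iff₀' (abs_pos.2 hz)]
        refine (hK.norm_resolventOp_apply_le hW hz _).trans ?_
        rw [lp.norm_single (by norm_num)]
        simp
    _ = _ := by simp [mul_assoc]

end RandomGreen

/-! ### Fractional moments off the real axis -/

section MomentBounds

variable {V : Type u} {k : ℕ} {G : SimpleGraph V} [G.LocallyFinite] {K : V → V → Mat k}
  {κ : ℕ} {b g s c lam ε : ℝ} {A B : V → Mat k} {z : ℂ} {μ : Measure ℝ}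

/-- Decoupling, at every site, for the single-site potentials `tA(x) + B(x)`. -/
def SiteDecoupling (μ : Measure ℝ) (A B : V → Mat k) (s c lam : ℝ) : Prop :=
  ∀ x, ∀ ε : ℝ, 0 < ε → ε ≤ 1 → ∀ (N F : Mat k) (X : ℝ → Mat k),
    (∀ t : ℝ, (1 + (t : ℂ) • N).det ≠ 0) → (∀ t : ℝ, (1 + (t : ℂ) • N) * X t = F) →
    ENNReal.ofReal ((1 + |lam|) ^ s) * ∫⁻ t, ENNReal.ofReal (‖X t‖ ^ s) ∂μ ≤
      ENNReal.ofReal c * ∫⁻ t : ℝ, ENNReal.ofReal (‖((t : ℂ) • A x + B x -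
        ((lam : ℂ) + ε * Complex.I) • (1 : Mat k)) * X t‖ ^ s) ∂μ

open Classical in
lemma sitePotential_update_self (f : V → ℝ) (x : V) (t : ℝ) :
    sitePotential A B (Function.update f x t) x = (t : ℂ) • A x + B x := by
  simp [sitePotential]

open Classical in
lemma sitePotential_update_of_ne (f : V → ℝ) {x y : V} (h : y ≠ x) (t : ℝ) :
    sitePotential A B (Function.update f x t) y = sitePotential A B f y := by
  simp [sitePotential, h]

open Classical in
-- Conditionally on the other sites, G(x,y) solves a linear pencil in t = v(x), so the single-site
-- decoupling applies before averaging over the rest.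
lemma IsBoundedHopping.lintegral_green_le_lintegral_mul [Countable V] [IsProbabilityMeasure μ]
    (hK : IsBoundedHopping G K κ b) (hA : ∀ x, (A x).IsHermitian) (hB : ∀ x, (B x).IsHermitian)
    (hdec : SiteDecoupling μ A B s c lam) (hε : 0 < ε) (hε1 : ε ≤ 1)
    (hz : z = lam + ε * Complex.I) (x y : V) :
    ENNReal.ofReal ((1 + |lam|) ^ s) *
        ∫⁻ f, ENNReal.ofReal (‖green G K g (sitePotential A B f) z x y‖ ^ s)
          ∂(Measure.infinitePi fun _ : V => μ) ≤
      ENNReal.ofReal c * ∫⁻ f, ENNReal.ofReal (‖(sitePotential A B f x - z • (1 : Mat k)) *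
        green G K g (sitePotential A B f) z x y‖ ^ s) ∂(Measure.infinitePi fun _ : V => μ) := by
  have hzim : z.im ≠ 0 := by rw [hz]; simpa using hε.ne'
  have hW := sitePotential_isHermitian hA hB
  have hm1 := hK.measurable_green_rpow (g := g) hA hB hzim x y s
  have hm2 : Measurable fun f : V → ℝ => ENNReal.ofReal (‖(sitePotential A B f x -
      z • (1 : Mat k)) * green G K g (sitePotential A B f) z x y‖ ^ s) := by
    have h1 : Continuous fun f : V → ℝ => sitePotential A B f x - z • (1 : Mat k) :=
      (continuous_sitePotential x).sub continuous_const
    exact (((h1.mul (hK.continuous_green hA hB hzim x y)).norm.measurable).pow_const s).ennreal_ofReal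
  rw [← lintegral_update_infinitePi μ x hm1, ← lintegral_update_infinitePi μ x hm2,
    ← lintegral_const_mul' _ _ ENNReal.ofReal_ne_top,
    ← lintegral_const_mul' _ _ ENNReal.ofReal_ne_top]
  refine lintegral_mono fun f => ?_
  -- The reference operator has v(x) = 0, so the perturbation is exactly tA(x), and N = G⁰(x,x)A(x),
  -- F = G⁰(x,y).
  have hx : ∀ t : ℝ, sitePotential A B (Function.update f x t) x =
      sitePotential A B (Function.update f x 0) x + (t : ℂ) • A x := fun t => by
    rw [sitePotential_update_self, sitePotential_update_self]
    simp [add_comm]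
  have hne : ∀ t : ℝ, ∀ u, u ≠ x → sitePotential A B (Function.update f x t) u =
      sitePotential A B (Function.update f x 0) u := fun t u hu => by
    rw [sitePotential_update_of_ne f hu, sitePotential_update_of_ne f hu]
  have h := hdec x ε hε hε1
    (green G K g (sitePotential A B (Function.update f x 0)) z x x * A x)
    (green G K g (sitePotential A B (Function.update f x 0)) z x y)
    (fun t => green G K g (sitePotential A B (Function.update f x t)) z x y) (fun t => ?_)
    (fun t => ?_)
  · simp only [sitePotential_update_self, hz] at h ⊢
    exact h
  · rw [← mul_smul_comm]
    exact hK.isUnit_det_one_add (hW _) (hW _) hzim (hx t) (hne t)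
  · rw [← mul_smul_comm, add_mul, one_mul]
    exact hK.green_perturb (hW _) (hW _) hzim (hx t) (hne t) y

open Classical in
lemma IsBoundedHopping.ofReal_norm_mul_green_le (hK : IsBoundedHopping G K κ b)
    {W : V → Mat k} (hW : ∀ x, (W x).IsHermitian) (hz : z.im ≠ 0) (hs : 0 < s) (hs1 : s ≤ 1)
    (hg : 0 < g) (x y : V) :
    ENNReal.ofReal (‖(W x - z • (1 : Mat k)) * green G K g W z x y‖ ^ s) ≤
      (if x = y then 1 else 0) + ENNReal.ofReal ((|b| / g) ^ s) *
        ∑ u ∈ G.neighborFinset x, ENNReal.ofReal (‖green G K g W z u y‖ ^ s) := by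
  have h0 := hK.green_eq (g := g) hW hz x y
  have h1 : ‖(W x - z • (1 : Mat k)) * green G K g W z x y‖ ≤
      (if x = y then 1 else 0) + ∑ u ∈ G.neighborFinset x, |b| / g * ‖green G K g W z u y‖ := by
    rw [eq_sub_of_add_eq h0]
    refine (norm_sub_le _ _).trans (add_le_add ?_ ?_)
    · split_ifs
      · exact norm_one_le
      · simp
    · rw [norm_smul, Complex.norm_real, Real.norm_eq_abs, abs_of_pos (inv_pos.2 hg)]
      calc g⁻¹ * ‖∑ u ∈ G.neighborFinset x, K x u * green G K g W z u y‖
          ≤ g⁻¹ * ∑ u ∈ G.neighborFinset x, |b| * ‖green G K g W z u y‖ := by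
            gcongr
            refine (norm_sum_le _ _).trans (Finset.sum_le_sum fun u hu => ?_)
            refine (norm_mul_le _ _).trans ?_
            gcongr
            exact (hK.norm_le x u ((SimpleGraph.mem_neighborFinset _ _ _).1 hu)).trans (le_abs_self b)
        _ = _ := by
            rw [Finset.mul_sum]
            refine Finset.sum_congr rfl fun u _ => ?_
            ring
  have hδ : (0 : ℝ) ≤ if x = y then 1 else 0 := by split_ifs <;> norm_num
  have hS : 0 ≤ ∑ u ∈ G.neighborFinset x, |b| / g * ‖green G K g W z u y‖ := by positivity
  calc ENNReal.ofReal (‖(W x - z • (1 : Mat k)) * green G K g W z x y‖ ^ s)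
      ≤ ENNReal.ofReal (((if x = y then 1 else 0) +
          ∑ u ∈ G.neighborFinset x, |b| / g * ‖green G K g W z u y‖) ^ s) := by gcongr
    _ ≤ ENNReal.ofReal ((if x = y then (1 : ℝ) else 0) ^ s) +
          ENNReal.ofReal ((∑ u ∈ G.neighborFinset x, |b| / g * ‖green G K g W z u y‖) ^ s) := by
        rw [← ENNReal.ofReal_add (by positivity) (by positivity)]
        exact ENNReal.ofReal_le_ofReal (Real.rpow_add_le_add_rpow hδ hS hs.le hs1)
    _ ≤ _ := by
        refine add_le_add ?_ ?_
        · split_ifs <;> simp [Real.zero_rpow hs.ne']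
        · refine (ofReal_rpow_sum_le _ _ (fun u => by positivity) hs hs1).trans (le_of_eq ?_)
          rw [Finset.mul_sum]
          refine Finset.sum_congr rfl fun u _ => ?_
          rw [Real.mul_rpow (by positivity) (norm_nonneg _), ENNReal.ofReal_mul (by positivity)]

open Classical in
lemma IsBoundedHopping.moment_subharmonic [Countable V] [IsProbabilityMeasure μ]
    (hK : IsBoundedHopping G K κ b) (hA : ∀ x, (A x).IsHermitian) (hB : ∀ x, (B x).IsHermitian)
    (hs : 0 < s) (hs1 : s ≤ 1) (hg : 0 < g) (hc : 0 < c)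
    (hdec : SiteDecoupling μ A B s c lam) (hε : 0 < ε) (hε1 : ε ≤ 1)
    (hz : z = lam + ε * Complex.I) (x y : V) :
    ∫⁻ f, ENNReal.ofReal (‖green G K g (sitePotential A B f) z x y‖ ^ s)
          ∂(Measure.infinitePi fun _ : V => μ) ≤
      ENNReal.ofReal (c / (1 + |lam|) ^ s) * (if x = y then 1 else 0) +
        ENNReal.ofReal (c / (1 + |lam|) ^ s * (|b| / g) ^ s) * ∑ u ∈ G.neighborFinset x,
          ∫⁻ f, ENNReal.ofReal (‖green G K g (sitePotential A B f) z u y‖ ^ s)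
          ∂(Measure.infinitePi fun _ : V => μ) := by
  have hzim : z.im ≠ 0 := by rw [hz]; simpa using hε.ne'
  have hW := sitePotential_isHermitian hA hB
  have hm := fun u => hK.measurable_green_rpow (g := g) hA hB hzim u y s
  have hl : 0 < (1 + |lam|) ^ s := by positivity
  have h1 := hK.lintegral_green_le_lintegral_mul (g := g) hA hB hdec hε hε1 hz x y
  have h2 : ∫⁻ f, ENNReal.ofReal (‖(sitePotential A B f x - z • (1 : Mat k)) *
        green G K g (sitePotential A B f) z x y‖ ^ s) ∂(Measure.infinitePi fun _ : V => μ) ≤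
      (if x = y then 1 else 0) + ENNReal.ofReal ((|b| / g) ^ s) *
        ∑ u ∈ G.neighborFinset x,
          ∫⁻ f, ENNReal.ofReal (‖green G K g (sitePotential A B f) z u y‖ ^ s)
          ∂(Measure.infinitePi fun _ : V => μ) := by
    refine (lintegral_mono fun f => hK.ofReal_norm_mul_green_le (hW f) hzim hs hs1 hg x y).trans ?_
    rw [lintegral_add_left measurable_const, lintegral_const, measure_univ, mul_one,
      lintegral_const_mul' _ _ ENNReal.ofReal_ne_top, lintegral_finsetSum _ fun u _ => hm u]
  have h3 := h1.trans (mul_le_mul_right h2 _)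
  have h4 : ENNReal.ofReal (1 / (1 + |lam|) ^ s) * ENNReal.ofReal ((1 + |lam|) ^ s) = 1 := by
    rw [← ENNReal.ofReal_mul (by positivity), one_div_mul_cancel hl.ne', ENNReal.ofReal_one]
  have h5 := mul_le_mul_right h3 (ENNReal.ofReal (1 / (1 + |lam|) ^ s))
  rw [← mul_assoc, h4, one_mul, ← mul_assoc, ← ENNReal.ofReal_mul (by positivity),
    one_div_mul_eq_div, mul_add, ← mul_assoc, ← ENNReal.ofReal_mul (by positivity)] at h5
  exact h5

open Classical in
/-- Fractional moment bounds off the real axis. -/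
lemma IsBoundedHopping.moment_bounds [Countable V] [IsProbabilityMeasure μ]
    (hK : IsBoundedHopping G K κ b) (hA : ∀ x, (A x).IsHermitian) (hB : ∀ x, (B x).IsHermitian)
    (hs : 0 < s) (hs1 : s ≤ 1) (hg : 0 < g) (hc : 0 < c)
    (hdec : SiteDecoupling μ A B s c lam)
    (hκ : κ * (c / (1 + |lam|) ^ s * (|b| / g) ^ s) ≤ 1 / 2) (hε : 0 < ε) (hε1 : ε ≤ 1)
    (hz : z = lam + ε * Complex.I) (y : V) :
    (∀ x, ∫⁻ f, ENNReal.ofReal (‖green G K g (sitePotential A B f) z x y‖ ^ s)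
          ∂(Measure.infinitePi fun _ : V => μ) ≤ ENNReal.ofReal (2 * (c / (1 + |lam|) ^ s) *
            powDist G (κ * (c / (1 + |lam|) ^ s * (|b| / g) ^ s)) x y)) ∧
      ∑' x, ∫⁻ f, ENNReal.ofReal (‖green G K g (sitePotential A B f) z x y‖ ^ s)
          ∂(Measure.infinitePi fun _ : V => μ) ≤ ENNReal.ofReal (2 * (c / (1 + |lam|) ^ s)) := by
  have hzim : z.im ≠ 0 := by rw [hz]; simpa using hε.ne'
  have hm := fun x => hK.moment_subharmonic hA hB hs hs1 hg hc hdec hε hε1 hz x y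
  -- This bound blows up as ε tends to 0, but only its finiteness matters: it does not appear in the
  -- conclusion.
  have hbd : ∀ x, ∫⁻ f, ENNReal.ofReal (‖green G K g (sitePotential A B f) z x y‖ ^ s)
      ∂(Measure.infinitePi fun _ : V => μ) ≤
        ENNReal.ofReal (((k * k : ℝ) * |z.im|⁻¹) ^ s) := fun x => by
    refine (lintegral_mono fun f => ENNReal.ofReal_le_ofReal (Real.rpow_le_rpow (norm_nonneg _)
      (hK.norm_green_le (sitePotential_isHermitian hA hB f) hzim x y) hs.le)).trans ?_
    rw [lintegral_const, measure_univ, mul_one]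
  have hρ0 : 0 ≤ c / (1 + |lam|) ^ s * (|b| / g) ^ s := by positivity
  have hρe : (κ : ℝ≥0∞) * ENNReal.ofReal (c / (1 + |lam|) ^ s * (|b| / g) ^ s) =
      ENNReal.ofReal (κ * (c / (1 + |lam|) ^ s * (|b| / g) ^ s)) := by
    rw [ENNReal.ofReal_mul (p := (κ : ℝ)) (by positivity), ENNReal.ofReal_natCast]
  have hρ : (κ : ℝ≥0∞) * ENNReal.ofReal (c / (1 + |lam|) ^ s * (|b| / g) ^ s) ≤ 1 / 2 := by
    rw [hρe]
    refine (ENNReal.ofReal_le_ofReal hκ).trans (le_of_eq ?_)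
    rw [ENNReal.ofReal_div_of_pos (by norm_num), ENNReal.ofReal_one, ENNReal.ofReal_ofNat]
  refine ⟨fun x => ?_, ?_⟩
  · refine (le_powDist_of_subharmonic hK.degree_le ENNReal.ofReal_ne_top hbd ENNReal.ofReal_ne_top
      hρ hm x).trans (le_of_eq ?_)
    rw [ENNReal.ofReal_mul (p := 2 * (c / (1 + |lam|) ^ s)) (by positivity),
      ENNReal.ofReal_mul (p := 2) (by norm_num), ENNReal.ofReal_ofNat, powDist, hρe]
    split_ifs
    · rw [ENNReal.ofReal_pow (by positivity)]
    · rw [ENNReal.ofReal_zero]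
  · refine (tsum_le_of_subharmonic hK.degree_le ENNReal.ofReal_ne_top hbd hρ hm).trans
      (le_of_eq ?_)
    rw [ENNReal.ofReal_mul (by norm_num), ENNReal.ofReal_ofNat]

end MomentBounds

/-! ### Limits at the real axis -/

section BoundaryValues

variable {V : Type u} {k : ℕ} {G : SimpleGraph V} [G.LocallyFinite] {K : V → V → Mat k}
  {κ : ℕ} {b g s lam : ℝ} {A B : V → Mat k}

/-- The inclusion of ℓ^s in ℓ²: sum ‖ψ(x)‖² ≤ ‖ψ‖^{2-s}‖ψ(x)‖^s over x and cancel ‖ψ‖^{2-s}. -/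
lemma ofReal_norm_rpow_le_tsum (ψ : L2 V k) (hs : 0 < s) (hs2 : s ≤ 2) :
    ENNReal.ofReal (‖ψ‖ ^ s) ≤ ∑' x, ENNReal.ofReal (‖ψ x‖ ^ s) := by
  rcases (norm_nonneg ψ).eq_or_lt with h0 | h0
  · rw [← h0, Real.zero_rpow hs.ne']
    simp
  have h1 : ENNReal.ofReal (‖ψ‖ ^ (2 - s)) * ENNReal.ofReal (‖ψ‖ ^ s) ≤
      ENNReal.ofReal (‖ψ‖ ^ (2 - s)) * ∑' x, ENNReal.ofReal (‖ψ x‖ ^ s) := by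
    have h2 : HasSum (fun x => ‖ψ x‖ ^ 2) (‖ψ‖ ^ 2) := by
      have := lp.hasSum_norm (p := 2) (by simp) ψ
      simpa using this
    calc ENNReal.ofReal (‖ψ‖ ^ (2 - s)) * ENNReal.ofReal (‖ψ‖ ^ s)
        = ENNReal.ofReal (‖ψ‖ ^ 2) := by
          rw [← ENNReal.ofReal_mul (by positivity), ← Real.rpow_add h0, sub_add_cancel,
            Real.rpow_two]
      _ = ∑' x, ENNReal.ofReal (‖ψ x‖ ^ 2) := by
          rw [← h2.tsum_eq, ENNReal.ofReal_tsum_of_nonneg (fun x => by positivity) h2.summable]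
      _ ≤ ∑' x, ENNReal.ofReal (‖ψ‖ ^ (2 - s)) * ENNReal.ofReal (‖ψ x‖ ^ s) := by
          refine ENNReal.tsum_le_tsum fun x => ?_
          rw [← ENNReal.ofReal_mul (by positivity)]
          refine ENNReal.ofReal_le_ofReal ?_
          rcases (norm_nonneg (ψ x)).eq_or_lt with hx | hx
          · rw [← hx, Real.zero_rpow hs.ne']
            simp
          · have h3 : ‖ψ x‖ ≤ ‖ψ‖ := lp.norm_apply_le_norm (by norm_num) ψ x
            calc ‖ψ x‖ ^ 2 = ‖ψ x‖ ^ (2 - s) * ‖ψ x‖ ^ s := by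
                  rw [← Real.rpow_add hx, sub_add_cancel, Real.rpow_two]
              _ ≤ _ := by
                  gcongr
      _ = _ := ENNReal.tsum_mul_left
  refine (ENNReal.mul_le_mul_iff_right ?_ ENNReal.ofReal_ne_top).1 h1
  simp
  positivity

open Classical in
/-- If the columns of the Green function have summable fractional moments uniformly off the real
axis, the boundary values exist almost surely and their moments are the limits. -/
theorem IsBoundedHopping.tendsto_boundary [Countable V] (hK : IsBoundedHopping G K κ b)
    (hA : ∀ x, (A x).IsHermitian) (hB : ∀ x, (B x).IsHermitian) (hs : 0 < s) (hs1 : s ≤ 1)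
    {Ω : Type w} [MeasurableSpace Ω] {P : Measure Ω} {f : Ω → V → ℝ}
    (hf : Measurable f) {M : ℝ≥0∞} (hM : M ≠ ⊤) (y : V)
    (hsum : ∀ ε : ℝ, 0 < ε → ε ≤ 1 → ∑' x, ∫⁻ ω, ENNReal.ofReal
      (‖green G K g (sitePotential A B (f ω)) (lam + ε * Complex.I) x y‖ ^ s) ∂P ≤ M) (x : V) :
    (∀ᵐ ω ∂P, Tendsto (fun ε : ℝ =>
        green G K g (sitePotential A B (f ω)) ((lam : ℂ) + (ε : ℂ) * Complex.I) x y)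
      (𝓝[>] 0) (𝓝 (greenBoundary G K g (sitePotential A B (f ω)) lam x y))) ∧
    Tendsto (fun ε : ℝ => fracMoment P s fun ω =>
        green G K g (sitePotential A B (f ω)) ((lam : ℂ) + (ε : ℂ) * Complex.I) x y)
      (𝓝[>] 0)
      (𝓝 (fracMoment P s fun ω => greenBoundary G K g (sitePotential A B (f ω)) lam x y)) := by
  have hW := sitePotential_isHermitian hA hB
  have him : ∀ ε : ℝ, 0 < ε → ((lam : ℂ) + (ε : ℂ) * Complex.I).im ≠ 0 := fun ε hε => by
    simpa using hε.ne'
  set φ : Fin k → L2 V k := fun j => lp.single 2 y (EuclideanSpace.single j (1 : ℂ)) with hφ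
  set ψ : Fin k → ℝ → Ω → L2 V k := fun j ε ω =>
    boundaryFamily G K g (sitePotential A B (f ω)) lam (φ j) ε with hψ
  have hmono : ∀ j ω (ε ε' : ℝ), 0 < ε' → ε' ≤ ε → ‖ψ j ε ω‖ ≤ ‖ψ j ε' ω‖ :=
    fun j ω ε ε' h h' => hK.norm_boundaryFamily_anti (hW (f ω)) lam (φ j) h h'
  have hψmeas : ∀ j (ε : ℝ), 0 < ε → Measurable fun ω => ENNReal.ofReal (‖ψ j ε ω‖ ^ s) := by
    intro j ε hε
    have h1 := (hK.continuous_resolventOp (g := g) (sitePotential_isHermitian hA hB)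
      continuous_sitePotential (him ε hε) (φ j)).norm.measurable
    exact ((h1.comp hf).pow_const s).ennreal_ofReal
  have hgmeas : ∀ (ε : ℝ), 0 < ε → ∀ x, Measurable fun ω => ENNReal.ofReal
      (‖green G K g (sitePotential A B (f ω)) (lam + ε * Complex.I) x y‖ ^ s) :=
    fun ε hε x => (hK.measurable_green_rpow (g := g) hA hB (him ε hε) x y s).comp hf
  have hcol : ∀ j (ε : ℝ), 0 < ε → ε ≤ 1 → ∫⁻ ω, ENNReal.ofReal (‖ψ j ε ω‖ ^ s) ∂P ≤ M := by
    intro j ε hε hε1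
    refine le_trans (lintegral_mono fun ω => ?_) ((lintegral_tsum fun x =>
      (hgmeas ε hε x).aemeasurable).trans_le (hsum ε hε hε1))
    refine (ofReal_norm_rpow_le_tsum _ hs (by linarith)).trans (ENNReal.tsum_le_tsum fun x => ?_)
    exact ENNReal.ofReal_le_ofReal (Real.rpow_le_rpow (norm_nonneg _)
      (norm_apply_single_le _ x y j) hs.le)
  set e : ℕ → ℝ := fun n => 1 / ((n : ℝ) + 1) with he
  have he0 : ∀ n, 0 < e n := fun n => by positivity
  have he1 : ∀ n, e n ≤ 1 := fun n => by
    rw [he, div_le_one (by positivity)]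
    linarith [Nat.cast_nonneg (α := ℝ) n]
  -- By monotonicity in ε, this countable supremum is the supremum over all ε > 0. It is measurable,
  -- and monotone convergence bounds its integral by M.
  set D : Fin k → Ω → ℝ≥0∞ := fun j ω => ⨆ n, ENNReal.ofReal (‖ψ j (e n) ω‖ ^ s) with hD
  have hDmeas : ∀ j, Measurable (D j) := fun j => Measurable.iSup fun n => hψmeas j _ (he0 n)
  have hDint : ∀ j, ∫⁻ ω, D j ω ∂P ≤ M := by
    intro j
    rw [lintegral_iSup (fun n => hψmeas j _ (he0 n))]
    · exact iSup_le fun n => hcol j _ (he0 n) (he1 n)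
    · intro m n hmn ω
      refine ENNReal.ofReal_le_ofReal (Real.rpow_le_rpow (norm_nonneg _)
        (hmono j ω _ _ (he0 n) ?_) hs.le)
      exact one_div_le_one_div_of_le (by positivity) (by exact_mod_cast Nat.succ_le_succ hmn)
  have hDle : ∀ j ω (ε : ℝ), 0 < ε → ENNReal.ofReal (‖ψ j ε ω‖ ^ s) ≤ D j ω := by
    intro j ω ε hε
    obtain ⟨n, hn⟩ := exists_nat_one_div_lt hε
    refine le_trans ?_ (le_iSup (fun n => ENNReal.ofReal (‖ψ j (e n) ω‖ ^ s)) n)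
    exact ENNReal.ofReal_le_ofReal (Real.rpow_le_rpow (norm_nonneg _)
      (hmono j ω _ _ (he0 n) hn.le) hs.le)
  have hDfin : ∀ᵐ ω ∂P, ∀ j, D j ω < ⊤ := by
    rw [ae_all_iff]
    intro j
    exact ae_lt_top (hDmeas j) ((hDint j).trans_lt hM.lt_top).ne
  have hconv : ∀ᵐ ω ∂P, Tendsto (fun ε : ℝ =>
        green G K g (sitePotential A B (f ω)) ((lam : ℂ) + (ε : ℂ) * Complex.I) x y)
      (𝓝[>] 0) (𝓝 (greenBoundary G K g (sitePotential A B (f ω)) lam x y)) := by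
    filter_upwards [hDfin] with ω hω
    have h1 : ∀ j, ∃ ψ0, Tendsto (boundaryFamily G K g (sitePotential A B (f ω)) lam (φ j))
        (𝓝[>] 0) (𝓝 ψ0) := by
      intro j
      refine hK.exists_tendsto_boundaryFamily (hW (f ω)) lam (φ j) (M := (D j ω).toReal ^ (1 / s))
        fun ε hε => ?_
      have h2 := hDle j ω ε hε
      rw [ENNReal.ofReal_le_iff_le_toReal (hω j).ne] at h2
      calc ‖ψ j ε ω‖ = (‖ψ j ε ω‖ ^ s) ^ (1 / s) := by
            rw [← Real.rpow_mul (norm_nonneg _), mul_one_div_cancel hs.ne', Real.rpow_one]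
        _ ≤ _ := by gcongr
    choose ψ0 hψ0 using h1
    refine tendsto_nhds_limUnder ⟨Matrix.of fun i j => ψ0 j x i, ?_⟩
    refine tendsto_pi_nhds.2 fun i => tendsto_pi_nhds.2 fun j => ?_
    have h2 : Continuous fun ψ : L2 V k => ψ x i :=
      (EuclideanSpace.proj i : Fib k →L[ℂ] ℂ).continuous.comp
        (lp.evalCLM ℂ (fun _ : V => Fib k) 2 x).continuous
    exact (h2.tendsto (ψ0 j)).comp (hψ0 j)
  refine ⟨hconv, ?_⟩
  -- Every entry in column j is bounded by the norm of the whole column, so the sum of the D j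
  -- dominates for all ε > 0.
  refine tendsto_lintegral_filter_of_dominated_convergence
    (fun ω => ∑ i : Fin k, ∑ j : Fin k, D j ω) ?_ ?_ ?_ ?_
  · filter_upwards [self_mem_nhdsWithin] with ε hε
    exact hgmeas ε hε x
  · filter_upwards [self_mem_nhdsWithin] with ε hε
    refine Eventually.of_forall fun ω => ?_
    refine (ENNReal.ofReal_le_ofReal (Real.rpow_le_rpow (norm_nonneg _)
      (norm_le_sum_entries _) hs.le)).trans ?_
    refine (ofReal_rpow_sum_le _ _ (fun i => by positivity) hs hs1).trans
      (Finset.sum_le_sum fun i _ => ?_)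
    refine (ofReal_rpow_sum_le _ _ (fun j => norm_nonneg _) hs hs1).trans
      (Finset.sum_le_sum fun j _ => ?_)
    refine le_trans ?_ (hDle j ω ε hε)
    exact ENNReal.ofReal_le_ofReal (Real.rpow_le_rpow (norm_nonneg _)
      (norm_kernelAt_entry_le _ x y i j) hs.le)
  · rw [lintegral_finsetSum _ fun i _ => Finset.measurable_sum _ fun j _ => hDmeas j]
    refine ENNReal.sum_ne_top.2 fun i _ => ?_
    rw [lintegral_finsetSum _ fun j _ => hDmeas j]
    exact ENNReal.sum_ne_top.2 fun j _ => ((hDint j).trans_lt hM.lt_top).ne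
  · filter_upwards [hconv] with ω hω
    exact ENNReal.tendsto_ofReal (hω.norm.rpow_const (Or.inr hs.le))

end BoundaryValues

/-! ### Exponents and coupling constants -/

section Constants

lemma powDist_le_powDist {V : Type u} (G : SimpleGraph V) {r r' : ℝ} (hr : 0 ≤ r) (h : r ≤ r')
    (x y : V) : powDist G r x y ≤ powDist G r' x y := by
  unfold powDist
  split_ifs
  · gcongr
  · exact le_rfl

lemma powDist_nonneg {V : Type u} (G : SimpleGraph V) {r : ℝ} (hr : 0 ≤ r) (x y : V) :
    0 ≤ powDist G r x y := by
  unfold powDist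
  split_ifs
  · positivity
  · exact le_rfl

/-- The hypothesis reads sk(2/q + 1/α) ≤ 1 with k = n + 1. Decoupling uses 2k - 1 in place of 2k,
whence strictness; the last bound leaves finitely many fibre dimensions. -/
lemma exponent_bounds {α q s : ℝ} (hα : 0 < α) (hq : 0 < q) (hs : 0 < s) {n : ℕ}
    (h : s ≤ α * q / (2 * (n + 1 : ℕ) * α + (n + 1 : ℕ) * q)) :
    s * (((n + (n + 1) : ℕ) : ℝ) / q + ((n + 1 : ℕ) : ℝ) / α) < 1 ∧ s < α ∧
      n < ⌈α * q / (s * (2 * α + q))⌉₊ := by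
  have hn : (0 : ℝ) ≤ n := Nat.cast_nonneg n
  push_cast at h ⊢
  rw [le_div_iff₀ (by positivity)] at h
  refine ⟨?_, ?_, ?_⟩
  · rw [div_add_div _ _ hq.ne' hα.ne', mul_div_assoc', div_lt_one (by positivity)]
    nlinarith [mul_pos hs hα]
  · have h1 : s * q < α * q := by nlinarith [mul_pos hs hα, mul_pos hs hq, mul_nonneg hn (mul_pos hs hα).le, mul_nonneg hn (mul_pos hs hq).le]
    exact lt_of_mul_lt_mul_right h1 hq.le
  · rw [Nat.lt_ceil, lt_div_iff₀ (by positivity)]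
    nlinarith [mul_pos hs hα, mul_pos hs hq]

/-- Taking s-th powers in the lower bound for g turns it into the contraction condition κρ ≤ 1/2. -/
lemma coupling_small {s c b g l C : ℝ} {κ : ℕ} (hs : 0 < s) (hc : 0 < c) (hg : 0 < g) (hl : 0 < l)
    (hC : (2 * c * |b| ^ s) ^ (1 / s) ≤ C) (hCg : C * (κ : ℝ) ^ (1 / s) / l ≤ g) :
    κ * (c / l ^ s * (|b| / g) ^ s) ≤ 1 / 2 := by
  rw [div_le_iff₀ hl] at hCg
  have h1 : (2 * c * |b| ^ s * κ) ^ (1 / s) ≤ g * l := by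
    rw [Real.mul_rpow (by positivity) (by positivity)]
    exact (mul_le_mul_of_nonneg_right hC (by positivity)).trans hCg
  have h2 : 2 * c * |b| ^ s * κ ≤ g ^ s * l ^ s := by
    rw [← Real.mul_rpow hg.le hl.le]
    calc 2 * c * |b| ^ s * κ = ((2 * c * |b| ^ s * κ) ^ (1 / s)) ^ s := by
          rw [← Real.rpow_mul (by positivity), one_div_mul_cancel hs.ne', Real.rpow_one]
      _ ≤ (g * l) ^ s := by gcongr
  have hgs : 0 < g ^ s := by positivity
  have hls : 0 < l ^ s := by positivity
  rw [Real.div_rpow (abs_nonneg b) hg.le, div_mul_div_comm, mul_div_assoc',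
    div_le_div_iff₀ (by positivity) (by norm_num)]
  linarith

end Constants

/-! ### The main theorem -/

theorem theorem1 (α q s CA1 CA2 CB1 CB2 CB3 : ℝ) (hα : 0 < α) (hq : 0 < q) (hs : 0 < s) :
    ∃ C : ℝ, 0 < C ∧
      ∀ (V : Type u) [Countable V] (G : SimpleGraph V) [G.LocallyFinite]
        (κ : ℕ) (_ : ∀ x, G.degree x ≤ κ)
        (k : ℕ) (_ : 1 ≤ k) (_ : s ≤ α * q / (2 * k * α + k * q))
        (Ω : Type w) [MeasurableSpace Ω] (P : Measure Ω) [IsProbabilityMeasure P]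
        (v : V → Ω → ℝ) (_ : ∀ x, Measurable (v x)) (_ : iIndepFun v P)
        (μ : Measure ℝ) [IsProbabilityMeasure μ] (_ : ∀ x, P.map (v x) = μ)
        (_ : IsAlphaRegular μ α CA1) (_ : HasMomentBound μ q CA2)
        (A B : V → Mat k) (_ : ∀ x, (A x).IsHermitian) (_ : ∀ x, (B x).IsHermitian)
        (_ : ∀ x, IsUnit (A x) ∧ ‖A x‖ ≤ CB1 ∧ ‖(A x)⁻¹‖ ≤ CB1)
        (_ : ∀ x, ‖B x‖ ≤ CB2)
        (K : V → V → Mat k) (_ : ∀ x y, G.Adj x y → K y x = (K x y)ᴴ ∧ ‖K x y‖ ≤ CB3)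
        (g : ℝ) (_ : 0 < g),
        -- the resolvent exists at every non-real energy
        (∀ ω (z : ℂ), z.im ≠ 0 → ∃ R,
          IsResolventAt (hamiltonian G K g (sitePotential A B fun x => v x ω)) z R) ∧
        ∀ lam : ℝ, C * (κ : ℝ) ^ (1 / s) / (1 + |lam|) ≤ g → ∀ x y : V,
          -- `G_{λ+i0}(x,y)` exists almost surely
          (∀ᵐ ω ∂P, Tendsto
            (fun ε : ℝ => green G K g (sitePotential A B fun x => v x ω)
              ((lam : ℂ) + (ε : ℂ) * Complex.I) x y)
            (𝓝[>] 0)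
            (𝓝 (greenBoundary G K g (sitePotential A B fun x => v x ω) lam x y))) ∧
          -- its fractional moment is the limit of those of `G_{λ+iε}(x,y)`
          Tendsto
            (fun ε : ℝ => fracMoment P s fun ω =>
              green G K g (sitePotential A B fun x => v x ω)
                ((lam : ℂ) + (ε : ℂ) * Complex.I) x y)
            (𝓝[>] 0)
            (𝓝 (fracMoment P s fun ω =>
              greenBoundary G K g (sitePotential A B fun x => v x ω) lam x y)) ∧
          fracMoment P s (fun ω =>
              greenBoundary G K g (sitePotential A B fun x => v x ω) lam x y)
            ≤ ENNReal.ofReal (C / (1 + |lam|) ^ s *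
                powDist G (C * κ / (g ^ s * (1 + |lam|) ^ s)) x y) := by
  have hex : ∀ n : ℕ, ∃ c : ℝ, 0 < c ∧ (s ≤ 1 →
      s * (((n + (n + 1) : ℕ) : ℝ) / q + ((n + 1 : ℕ) : ℝ) / α) < 1 →
      ∀ μ : Measure ℝ, IsProbabilityMeasure μ → IsAlphaRegular μ α CA1 → HasMomentBound μ q CA2 →
      ∀ (V : Type u) (A B : V → Mat (n + 1)),
        (∀ x, IsUnit (A x) ∧ ‖A x‖ ≤ CB1 ∧ ‖(A x)⁻¹‖ ≤ CB1) → (∀ x, ‖B x‖ ≤ CB2) →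
        ∀ lam : ℝ, SiteDecoupling μ A B s c lam) := by
    intro n
    by_cases h : s ≤ 1 ∧ s * (((n + (n + 1) : ℕ) : ℝ) / q + ((n + 1 : ℕ) : ℝ) / α) < 1
    · obtain ⟨c, hc, hdec⟩ := exists_pencil_decoupling (C₁ := CA1) (C₂ := CA2) (b₁ := CB1)
        (b₂ := CB2) hα hq hs h.1 n h.2
      refine ⟨c, hc, fun _ _ μ hμ hreg hmb V A B hA hB lam x ε hε hε1 => ?_⟩
      exact hdec μ hμ hreg hmb (A x) (B x) (hA x).1 (hA x).2.1 (hA x).2.2 (hB x) lam ε hε hε1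
    -- The constants are fixed before k is known; where the exponent conditions fail, any positive
    -- value will do.
    · exact ⟨1, one_pos, fun h1 h2 => absurd ⟨h1, h2⟩ h⟩
  choose c hc hdec using hex
  -- The three summands serve the prefactor 2a, the base κρ of the decay, and the contraction
  -- condition. Summing over the admissible n makes C independent of k.
  set Cn : ℕ → ℝ := fun n => 2 * c n + c n * |CB3| ^ s + (2 * c n * |CB3| ^ s) ^ (1 / s) with hCn
  have hCn0 : ∀ n, 0 ≤ Cn n := fun n => by
    have := hc n
    positivity
  refine ⟨1 + ∑ n ∈ Finset.range ⌈α * q / (s * (2 * α + q))⌉₊, Cn n,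
    add_pos_of_pos_of_nonneg one_pos (Finset.sum_nonneg fun n _ => hCn0 n), ?_⟩
  intro V _ G _ κ hdeg k hk hsk Ω _ P _ v hv hind μ _ hvμ hreg hmb A B hA hB hAb hBb K hKh g hg
  obtain ⟨n, rfl⟩ : ∃ n, k = n + 1 := ⟨k - 1, by omega⟩
  obtain ⟨hexp, hsα, hn⟩ := exponent_bounds hα hq hs hsk
  have hs1 : s ≤ 1 := hsα.le.trans hreg.exponent_le_one
  have hK : IsBoundedHopping G K κ CB3 :=
    ⟨hdeg, fun x y h => (hKh x y h).1, fun x y h => (hKh x y h).2⟩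
  set C := 1 + ∑ n ∈ Finset.range ⌈α * q / (s * (2 * α + q))⌉₊, Cn n with hC
  have hCge : Cn n ≤ C := by
    have := Finset.single_le_sum (fun i _ => hCn0 i) (Finset.mem_range.2 hn)
    linarith
  have hb0 : 0 ≤ |CB3| ^ s := by positivity
  have hcn := hc n
  have h20 : 0 ≤ c n * |CB3| ^ s := by positivity
  have h30 : 0 ≤ (2 * c n * |CB3| ^ s) ^ (1 / s) := by positivity
  simp only [hCn] at hCge
  refine ⟨fun ω z hz => hK.exists_isResolventAt (sitePotential_isHermitian hA hB _) hz, ?_⟩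
  intro lam hlam x y
  have hl : 0 < 1 + |lam| := by positivity
  have hsmall := coupling_small hs hcn hg hl (b := CB3) (by linarith) hlam
  have hD := hdec n hs1 hexp μ inferInstance hreg hmb V A B hAb hBb lam
  have hvm : Measurable fun ω x => v x ω := measurable_pi_iff.2 hv
  have hlaw : P.map (fun ω x => v x ω) = Measure.infinitePi fun _ : V => μ := by
    rw [(iIndepFun_iff_map_fun_eq_infinitePi_map hv).1 hind]
    simp only [hvμ]
  have hmom : ∀ ε : ℝ, 0 < ε → ∀ x, ∫⁻ ω, ENNReal.ofReal
      (‖green G K g (sitePotential A B fun x => v x ω) (lam + ε * Complex.I) x y‖ ^ s) ∂P =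
      ∫⁻ f, ENNReal.ofReal (‖green G K g (sitePotential A B f) (lam + ε * Complex.I) x y‖ ^ s)
        ∂(Measure.infinitePi fun _ : V => μ) := by
    intro ε hε x
    rw [← hlaw, lintegral_map (hK.measurable_green_rpow hA hB (by simpa using hε.ne') x y s) hvm]
  have hbounds := fun (ε : ℝ) (hε : 0 < ε) (hε1 : ε ≤ 1) =>
    hK.moment_bounds hA hB hs hs1 hg hcn hD hsmall hε hε1 rfl y
  obtain ⟨hlim, hmlim⟩ := hK.tendsto_boundary (g := g) (lam := lam) hA hB hs hs1 hvm
    ENNReal.ofReal_ne_top y (fun ε hε hε1 =>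
      (tsum_congr (hmom ε hε)).trans_le (hbounds ε hε hε1).2) x
  refine ⟨hlim, hmlim, ?_⟩
  -- The bounds for 0 < ε ≤ 1 do not depend on ε, and the moments converge, so the bound passes to
  -- the limit.
  refine le_of_tendsto hmlim ?_
  filter_upwards [Ioc_mem_nhdsGT one_pos] with ε hε
  rw [fracMoment, hmom ε hε.1]
  refine ((hbounds ε hε.1 hε.2).1 x).trans (ENNReal.ofReal_le_ofReal ?_)
  have hls : 0 < (1 + |lam|) ^ s := by positivity
  have hgs : 0 < g ^ s := by positivity
  have hr : κ * (c n / (1 + |lam|) ^ s * (|CB3| / g) ^ s) ≤ C * κ / (g ^ s * (1 + |lam|) ^ s) := by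
    rw [Real.div_rpow (abs_nonneg _) hg.le, div_mul_div_comm, mul_div_assoc',
      mul_comm (g ^ s)]
    refine div_le_div_of_nonneg_right ?_ (by positivity)
    rw [mul_comm]
    exact mul_le_mul_of_nonneg_right (by linarith) (Nat.cast_nonneg κ)
  have hr0 : 0 ≤ κ * (c n / (1 + |lam|) ^ s * (|CB3| / g) ^ s) := by positivity
  rw [mul_div_assoc']
  refine mul_le_mul ?_ (powDist_le_powDist G hr0 hr x y) (powDist_nonneg G hr0 x y) ?_
  · gcongr
    linarith
  · have : 0 ≤ C := by linarith
    positivity
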